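/- Let $X$ be a separable real Hilbert space, $\nu$ a Borel probability measure on $X$, and let $C^1_b(X)$ be the space of bounded, continuously Fréchet differentiable functions $\varphi:X\to\mathbb R$ with bounded gradient. Let $R\in\mathcal L(X)$ be such that for every $z\in X$ there is $v_z\in\bigcap_{1<q<\infty}L^q(X,\nu)$ with $$\int_X\langle R\nabla\varphi,z\rangle\,d\nu=\int_X v_z\,\varphi\,d\nu,\qquad \varphi\in C^1_b(X).$$ Assume that $R=R^*$ is injective and that $X$ has an orthonormal basis consisting of eigenvectors of $R$. Let $\widetilde C^1_b(X,R(X))$ be the set of vector fields $F=\sum_{i=1}^n f_i\,y_i$ with $n\in\mathbb N$, $f_i\in C^1_b(X)$, $y_i\in R(X)$. For such $F$ let $\nabla^*F$ be the image of $F$ under the adjoint of the gradient, that is, the ($\nu$-a.e. unique) function in $\bigcap_{1<q<\infty}L^q(X,\nu)$ such that $\int_X\langle\nabla\varphi,F\rangle\,d\nu=\int_X\varphi\,\nabla^*F\,d\nu$ for all $\varphi\in C^1_b(X)$; explicitly $\nabla^*F=\sum_{i=1}^n(-\langle\nabla f_i,y_i\rangle+v_{R^{-1}y_i}f_i)$.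 For $u\in L^1(X,\nu)$ with $uv_z\in L^1(X,\nu)$ for every $z\in X$ set $$V_0(u):=\sup\Big\{\int_X u\,\nabla^*F\,d\nu:\ F\in\widetilde C^1_b(X,R(X)),\ \|F(x)\|\le 1\ \ \forall x\in X\Big\}\in[0,\infty],$$ and say that $u\in BV_0(X,\nu)$ if there is a countably additive $X$-valued Borel measure $m_0$ with finite total variation $|m_0|(X)$ such that, for every $y\in R(X)$ and every $\varphi\in C^1_b(X)$, $$\int_X u\,\big(\langle\nabla\varphi,y\rangle-v_{R^{-1}y}\,\varphi\big)\,d\nu=-\int_X\varphi\,d\langle m_0,y\rangle,\qquad \langle m_0,y\rangle(B):=\langle m_0(B),y\rangle.$$ Let $p>1$ and $u\in L^p(X,\nu)$. Then $u\in BV_0(X,\nu)$ if and only if $V_0(u)<\infty$. In this case every measure $m_0$ as in the definition of $BV_0(X,\nu)$ satisfies $|m_0|(X)=V_0(u)$. -/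

import Mathlib

open MeasureTheory Set
open scoped ENNReal

namespace BVHilbert

noncomputable section

variable {X : Type*} [NormedAddCommGroup X] [InnerProductSpace ℝ X] [CompleteSpace X]

/-- `C¹_b(X)`: bounded, continuously Fréchet differentiable real functions with bounded gradient. -/
structure IsC1b (φ : X → ℝ) : Prop where
  contDiff : ContDiff ℝ 1 φ
  bounded : ∃ C : ℝ, ∀ x, |φ x| ≤ C
  grad_bounded : ∃ C : ℝ, ∀ x, ‖gradient φ x‖ ≤ C

/-- The vector fields `F = ∑ i, f i • y i` (finite sums) with `f i ∈ C¹_b(X)` and `y i` in the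
subspace `Y` of `X`. -/
def TildeC1b (Y : Submodule ℝ X) : Set (X → X) :=
  {F | ∃ (n : ℕ) (f : Fin n → X → ℝ) (y : Fin n → X),
    (∀ i, IsC1b (f i)) ∧ (∀ i, y i ∈ Y) ∧ F = fun x => ∑ i, f i x • y i}

variable [MeasurableSpace X]

/-- The family `v` consists of the logarithmic derivatives of `ν` (up to the sign) along the range
of the adjoint of `R`: each `v z` belongs to `L^p(X, ν)` for every `1 < p < ∞`, and
`∫ ⟨R ∇φ, z⟩ dν = ∫ v_z φ dν` for all `φ ∈ C¹_b(X)`. -/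
structure IsLogDerivFamily (ν : Measure X) (R : X →L[ℝ] X) (v : X → X → ℝ) : Prop where
  memLp : ∀ (z : X) (p : ℝ≥0∞), 1 < p → p < ∞ → MemLp (v z) p ν
  integral_eq : ∀ (z : X) (φ : X → ℝ), IsC1b φ →
    ∫ x, inner ℝ (R (gradient φ x)) z ∂ν = ∫ x, v z x * φ x ∂ν

/-- `F` belongs to the domain of the adjoint of the gradient, seen as an operator from
`C¹_b(X) ⊆ L^p(X, ν)` to `L^p(X, ν; X)`, and `g` is its image; `q` is the exponent conjugate to
`p`. (A densely defined closable operator and its closure have the same adjoint.) -/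
structure IsGradAdjoint (ν : Measure X) (q : ℝ≥0∞) (F : X → X) (g : X → ℝ) : Prop where
  memLp_field : MemLp F q ν
  memLp_image : MemLp g q ν
  integral_eq : ∀ φ : X → ℝ, IsC1b φ →
    ∫ x, inner ℝ (gradient φ x) (F x) ∂ν = ∫ x, φ x * g x ∂ν

/-- `g = ∇^* F`: for every `1 < p < ∞` the field `F` is in the domain of the adjoint of the
`L^p`-gradient and is sent to `g`. -/
def IsNablaStar (ν : Measure X) (F : X → X) (g : X → ℝ) : Prop :=
  ∀ p q : ℝ≥0∞, 1 < p → p < ∞ → p.HolderConjugate q → IsGradAdjoint ν q F g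

/-- `V_0(u)`, the supremum of `∫ u ∇^*F dν` over the fields `F` with values in a
finite-dimensional subspace of `R(X)`, with coefficients in `C¹_b(X)` and with `‖F‖ ≤ 1`
everywhere. The field `F = 0` is admissible, so that the supremum is nonnegative. -/
def V0 (ν : Measure X) (R : X →L[ℝ] X) (u : X → ℝ) : ℝ≥0∞ :=
  ⨆ (F : X → X) (g : X → ℝ) (_ : F ∈ TildeC1b R.range) (_ : ∀ x, ‖F x‖ ≤ 1)
    (_ : IsNablaStar ν F g), ENNReal.ofReal (∫ x, u x * g x ∂ν)

/-- The signed measure `⟨m, y⟩(B) = ⟨m(B), y⟩`. -/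
def innerMeasure (m : VectorMeasure X X) (y : X) : SignedMeasure X :=
  m.mapRange (innerSL ℝ y : X →L[ℝ] ℝ).toLinearMap.toAddMonoidHom (innerSL ℝ y).continuous

/-- `m₀` is an `X`-valued Borel measure with finite total variation such that, for all `y` in the
range of the injective operator `R` and all `φ ∈ C¹_b(X)`,
`∫ u (⟨∇φ, y⟩ - v_{R⁻¹ y} φ) dν = - ∫ φ d⟨m₀, y⟩`. Here `R⁻¹ y` is the point `z` with `R z = y`. -/
structure IsBV0Measure (ν : Measure X) (R : X →L[ℝ] X) (v : X → X → ℝ) (u : X → ℝ)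
    (m₀ : VectorMeasure X X) : Prop where
  variation_lt_top : m₀.variation univ < ∞
  integral_eq : ∀ y z : X, R z = y → ∀ φ : X → ℝ, IsC1b φ →
    ∫ x, u x * (inner ℝ (gradient φ x) y - v z x * φ x) ∂ν
      = - VectorMeasure.integral (innerMeasure m₀ y) φ (ContinuousLinearMap.lsmul ℝ ℝ)

/-- `u ∈ BV_0(X, ν)`. -/
structure IsBV0 (ν : Measure X) (R : X →L[ℝ] X) (v : X → X → ℝ) (u : X → ℝ) : Prop where
  integrable : Integrable u ν
  integrable_mul : ∀ z : X, Integrable (fun x => u x * v z x) ν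
  exists_measure : ∃ m₀ : VectorMeasure X X, IsBV0Measure ν R v u m₀

end

end BVHilbert

/-!
Write `L(F) = ∫ u ∇^*F dν`. For `F = ∑ i, f i • R (z i)` this is `∑ i, pairing ν R v u (f i) (z i)`,
since integration by parts gives `∇^*F` explicitly and `C¹_b(X)` separates the points of `L¹(X, ν)`
(`measure_ext_of_isC1b`, through characteristic functions). Thus `V₀(u)` is the norm of `L` on the
fields bounded by `1` (`le_V0`, `V0_le`), and `m₀` is a measure as in the definition of `BV₀` if and
only if `L(F) = ∫ ⟨F, dm₀⟩` for all `F`.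

*The total variation.* The inequality `V₀(u) ≤ |m₀|(X)` is the norm bound for vector integrals. For
the converse, `|m₀|(X)` is nearly attained by a step field whose values are `0` or unit vectors of the
dense subspace `R(X)`. As `C¹_b(X)` is dense in `L²(X, |m₀|)`, such a field is approximated by fields
of class `C¹_b`, which are brought into the unit ball by `y ↦ 2 y / (1 + ‖y‖²)`, a map which fixes
the unit vectors and the origin (`IsBV0Measure.sum_norm_le`).

*Existence.* Suppose `V₀(u) < ∞`. As `X` is not locally compact, the Riesz-Markov-Kakutani theorem is
applied on the compact space `K = [-∞, ∞]^ι`, into which `X` is mapped by its coordinates in the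
Hilbert basis. The Riesz extension theorem, applied to the cone of the pairs `(f, F)` with `‖F‖ ≤ f`,
yields a measure `μ` on `K` of mass `V₀(u)` with `L(F) ≤ ∫ ‖F‖ dμ` for the fields which extend to
`K` (`exists_measure_le_integral`).
A field `F` is approximated by `F (P x) exp (-t ‖P x‖²)`, with `P` a finite-dimensional coordinate
projection, which does extend to `K`. The gradient of the Gaussian factor is `O(√t)`, so
that `L` passes to the limit (`tendsto_pairing_cutoff`). On the other hand the Gaussian factors tend
to `0` outside of the square summable sequences. Hence the latter carry a mass at least `V₀(u)`, that
is, `μ` is carried by `X`, and `L(F) ≤ ∫ ‖F‖ dμ` holds for all fields `F`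
(`exists_measure_sum_pairing_le`). In particular `L` is continuous for the norm of `L²(X, μ; X)`, and
it is represented by a density `ρ` there; then `m₀ = ρ μ`.
-/

namespace BVHilbert

open Filter Topology

set_option linter.unusedSectionVars false

/-! ### Functions of class `C¹_b` -/

section C1b

variable {X : Type*} [NormedAddCommGroup X] [InnerProductSpace ℝ X] [CompleteSpace X]

lemma norm_gradient (φ : X → ℝ) (x : X) : ‖gradient φ x‖ = ‖fderiv ℝ φ x‖ := by
  simp [gradient]

lemma inner_gradient (φ : X → ℝ) (x y : X) : inner ℝ (gradient φ x) y = fderiv ℝ φ x y := by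
  rw [← toDual_gradient, InnerProductSpace.toDual_apply_apply]

lemma IsC1b.of_fderiv {φ : X → ℝ} (h : ContDiff ℝ 1 φ) {C D : ℝ} (hC : ∀ x, |φ x| ≤ C)
    (hD : ∀ x, ‖fderiv ℝ φ x‖ ≤ D) : IsC1b φ :=
  ⟨h, ⟨C, hC⟩, ⟨D, fun x => by rw [norm_gradient]; exact hD x⟩⟩

lemma IsC1b.differentiable {φ : X → ℝ} (h : IsC1b φ) : Differentiable ℝ φ :=
  h.contDiff.differentiable one_ne_zero

lemma IsC1b.continuous {φ : X → ℝ} (h : IsC1b φ) : Continuous φ := h.contDiff.continuous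

lemma IsC1b.continuous_fderiv_apply {φ : X → ℝ} (h : IsC1b φ) (y : X) :
    Continuous fun x => fderiv ℝ φ x y :=
  (h.contDiff.continuous_fderiv one_ne_zero).clm_apply continuous_const

lemma IsC1b.exists_bound {φ : X → ℝ} (h : IsC1b φ) :
    ∃ C : ℝ, 0 ≤ C ∧ (∀ x, |φ x| ≤ C) ∧ ∀ x, ‖fderiv ℝ φ x‖ ≤ C := by
  obtain ⟨C, hC⟩ := h.bounded
  obtain ⟨D, hD⟩ := h.grad_bounded
  refine ⟨max C D, ?_, fun x => (hC x).trans (le_max_left _ _), fun x => ?_⟩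
  · exact (abs_nonneg (φ 0)).trans ((hC 0).trans (le_max_left _ _))
  · rw [← norm_gradient]; exact (hD x).trans (le_max_right _ _)

lemma isC1b_const (c : ℝ) : IsC1b fun _ : X => c :=
  .of_fderiv contDiff_const (C := |c|) (D := 0) (fun _ => le_rfl) (fun x => by simp)

lemma IsC1b.add {f g : X → ℝ} (hf : IsC1b f) (hg : IsC1b g) : IsC1b fun x => f x + g x := by
  obtain ⟨C, -, hC, hC'⟩ := hf.exists_bound
  obtain ⟨D, -, hD, hD'⟩ := hg.exists_bound
  refine .of_fderiv (hf.contDiff.add hg.contDiff) (C := C + D) (D := C + D)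
    (fun x => (abs_add_le _ _).trans (add_le_add (hC x) (hD x))) fun x => ?_
  rw [fderiv_fun_add (hf.differentiable x) (hg.differentiable x)]
  exact (norm_add_le _ _).trans (add_le_add (hC' x) (hD' x))

lemma IsC1b.mul {f g : X → ℝ} (hf : IsC1b f) (hg : IsC1b g) : IsC1b fun x => f x * g x := by
  obtain ⟨C, hC0, hC, hC'⟩ := hf.exists_bound
  obtain ⟨D, hD0, hD, hD'⟩ := hg.exists_bound
  refine .of_fderiv (hf.contDiff.mul hg.contDiff) (C := C * D) (D := C * D + D * C)
    (fun x => ?_) fun x => ?_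
  · rw [abs_mul]
    exact mul_le_mul (hC x) (hD x) (abs_nonneg _) hC0
  · rw [fderiv_fun_mul (hf.differentiable x) (hg.differentiable x)]
    refine (norm_add_le _ _).trans (add_le_add ?_ ?_) <;> rw [norm_smul, Real.norm_eq_abs]
    · exact mul_le_mul (hC x) (hD' x) (norm_nonneg _) hC0
    · exact mul_le_mul (hD x) (hC' x) (norm_nonneg _) hD0

lemma IsC1b.const_mul {f : X → ℝ} (hf : IsC1b f) (c : ℝ) : IsC1b fun x => c * f x :=
  (isC1b_const c).mul hf

lemma IsC1b.sum {κ : Type*} (s : Finset κ) {f : κ → X → ℝ} (hf : ∀ i ∈ s, IsC1b (f i)) :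
    IsC1b fun x => ∑ i ∈ s, f i x := by
  classical
  induction s using Finset.induction_on with
  | empty => simpa using isC1b_const (X := X) 0
  | insert a s ha ih =>
    simp only [Finset.sum_insert ha]
    exact (hf a (by simp)).add (ih fun i hi => hf i (by simp [hi]))

lemma IsC1b.inv {f : X → ℝ} (hf : IsC1b f) {c : ℝ} (hc : 0 < c) (hcf : ∀ x, c ≤ f x) :
    IsC1b fun x => (f x)⁻¹ := by
  obtain ⟨C, hC0, hC, hC'⟩ := hf.exists_bound
  have hpos : ∀ x, 0 < f x := fun x => hc.trans_le (hcf x)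
  refine .of_fderiv (hf.contDiff.inv fun x => (hpos x).ne') (C := c⁻¹) (D := (c ^ 2)⁻¹ * C)
    (fun x => ?_) fun x => ?_
  · rw [abs_of_pos (inv_pos.2 (hpos x))]
    exact inv_anti₀ hc (hcf x)
  · have h : HasFDerivAt (fun x => (f x)⁻¹) (-(f x ^ 2)⁻¹ • fderiv ℝ f x) x :=
      (hasDerivAt_inv (hpos x).ne').comp_hasFDerivAt x (hf.differentiable x).hasFDerivAt
    rw [h.fderiv, norm_smul, norm_neg, Real.norm_eq_abs, abs_of_pos (inv_pos.2 (pow_pos (hpos x) 2))]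
    refine mul_le_mul (inv_anti₀ (pow_pos hc 2) ?_) (hC' x) (norm_nonneg _) (by positivity)
    exact pow_le_pow_left₀ hc.le (hcf x) 2

lemma IsC1b.comp_clm {f : X → ℝ} (hf : IsC1b f) (A : X →L[ℝ] X) : IsC1b fun x => f (A x) := by
  obtain ⟨C, hC0, hC, hC'⟩ := hf.exists_bound
  refine .of_fderiv (hf.contDiff.comp A.contDiff) (C := C) (D := C * ‖A‖) (fun x => hC _) fun x => ?_
  have h : HasFDerivAt (fun x => f (A x)) ((fderiv ℝ f (A x)).comp A) x :=
    (hf.differentiable (A x)).hasFDerivAt.comp x A.hasFDerivAt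
  rw [h.fderiv]
  exact (ContinuousLinearMap.opNorm_comp_le _ _).trans
    (mul_le_mul_of_nonneg_right (hC' _) (norm_nonneg _))

lemma fderiv_comp_clm {f : X → ℝ} (hf : IsC1b f) (A : X →L[ℝ] X) (x y : X) :
    fderiv ℝ (fun x => f (A x)) x y = fderiv ℝ f (A x) (A y) := by
  have h : HasFDerivAt (fun x => f (A x)) ((fderiv ℝ f (A x)).comp A) x :=
    (hf.differentiable (A x)).hasFDerivAt.comp x A.hasFDerivAt
  rw [h.fderiv]
  rfl

/-- One-dimensional profiles such as `cos` and `sin`. -/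
lemma isC1b_comp_inner (ξ : X) {θ θ' : ℝ → ℝ} (hθ : ContDiff ℝ 1 θ)
    (hd : ∀ s, HasDerivAt θ (θ' s) s) (h1 : ∀ s, |θ s| ≤ 1) (h2 : ∀ s, |θ' s| ≤ 1) :
    IsC1b fun x : X => θ (inner ℝ x ξ) := by
  refine .of_fderiv (hθ.comp (contDiff_id.inner ℝ contDiff_const)) (C := 1) (D := ‖ξ‖)
    (fun x => h1 _) fun x => ?_
  have hi : HasFDerivAt (fun x : X => inner ℝ x ξ) (innerSL ℝ ξ) x := by
    have := (innerSL ℝ ξ).hasFDerivAt (x := x)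
    refine this.congr_of_eventuallyEq (.of_forall fun z => ?_)
    simp [real_inner_comm]
  have hc : HasFDerivAt (fun x : X => θ (inner ℝ x ξ)) (θ' (inner ℝ x ξ) • innerSL ℝ ξ) x :=
    (hd _).comp_hasFDerivAt x hi
  rw [hc.fderiv, norm_smul, innerSL_apply_norm, Real.norm_eq_abs]
  exact mul_le_of_le_one_left (norm_nonneg _) (h2 _)

lemma isC1b_cos_inner (ξ : X) : IsC1b fun x : X => Real.cos (inner ℝ x ξ) :=
  isC1b_comp_inner ξ Real.contDiff_cos Real.hasDerivAt_cos Real.abs_cos_le_one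
    fun s => by simpa using Real.abs_sin_le_one s

lemma isC1b_sin_inner (ξ : X) : IsC1b fun x : X => Real.sin (inner ℝ x ξ) :=
  isC1b_comp_inner ξ Real.contDiff_sin Real.hasDerivAt_sin Real.abs_sin_le_one Real.abs_cos_le_one

lemma hasFDerivAt_gauss (t : ℝ) (A : X →L[ℝ] X) (x : X) :
    HasFDerivAt (fun x => Real.exp (-t * ‖A x‖ ^ 2))
      (Real.exp (-t * ‖A x‖ ^ 2) • (-t) • (2 • (innerSL ℝ (A x)).comp A)) x :=
  ((A.hasFDerivAt.norm_sq).const_mul (-t)).exp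

/-- `s e^{-s²} ≤ 1`, rescaled: this makes the gradient of `exp (-t ‖x‖²)` of size `O(√t)`. -/
lemma mul_mul_exp_neg_sq_le {t : ℝ} (ht : 0 < t) (r : ℝ) :
    t * r * Real.exp (-t * r ^ 2) ≤ √t := by
  have h1 : √t * r ≤ Real.exp (t * r ^ 2) := by
    have := Real.add_one_le_exp (t * r ^ 2)
    have h2 : (√t * r) ^ 2 = t * r ^ 2 := by rw [mul_pow, Real.sq_sqrt ht.le]
    nlinarith [sq_nonneg (√t * r - 1)]
  have h3 : √t * √t = t := Real.mul_self_sqrt ht.le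
  calc t * r * Real.exp (-t * r ^ 2)
      = √t * (√t * r) * Real.exp (-t * r ^ 2) := by rw [← mul_assoc, h3]
    _ ≤ √t * Real.exp (t * r ^ 2) * Real.exp (-t * r ^ 2) := by gcongr
    _ = √t := by rw [mul_assoc, ← Real.exp_add]; simp

lemma abs_fderiv_gauss_apply_le {t : ℝ} (ht : 0 < t) (A : X →L[ℝ] X) (x y : X) :
    |fderiv ℝ (fun x => Real.exp (-t * ‖A x‖ ^ 2)) x y| ≤ 2 * √t * ‖A y‖ := by
  rw [(hasFDerivAt_gauss t A x).fderiv]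
  have h : (Real.exp (-t * ‖A x‖ ^ 2) • (-t) • (2 • (innerSL ℝ (A x)).comp A)) y
      = -(2 * (t * Real.exp (-t * ‖A x‖ ^ 2)) * inner ℝ (A x) (A y)) := by
    simp; ring
  rw [h, abs_neg, abs_mul, abs_of_nonneg (by positivity)]
  calc 2 * (t * Real.exp (-t * ‖A x‖ ^ 2)) * |inner ℝ (A x) (A y)|
      ≤ 2 * (t * Real.exp (-t * ‖A x‖ ^ 2)) * (‖A x‖ * ‖A y‖) := by
        gcongr; exact abs_real_inner_le_norm _ _
    _ = 2 * (t * ‖A x‖ * Real.exp (-t * ‖A x‖ ^ 2)) * ‖A y‖ := by ring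
    _ ≤ 2 * √t * ‖A y‖ := by gcongr; exact mul_mul_exp_neg_sq_le ht _

lemma isC1b_gauss {t : ℝ} (ht : 0 < t) (A : X →L[ℝ] X) :
    IsC1b fun x : X => Real.exp (-t * ‖A x‖ ^ 2) := by
  refine .of_fderiv ((contDiff_const.mul (A.contDiff.norm_sq ℝ)).exp) (C := 1)
    (D := 2 * √t * ‖A‖) (fun x => ?_) fun x => ?_
  · rw [Real.abs_exp]
    exact Real.exp_le_one_iff.2 (by nlinarith [sq_nonneg ‖A x‖])
  · refine ContinuousLinearMap.opNorm_le_bound _ (by positivity) fun y => ?_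
    calc _ ≤ 2 * √t * ‖A y‖ := abs_fderiv_gauss_apply_le ht A x y
      _ ≤ 2 * √t * (‖A‖ * ‖y‖) := by gcongr; exact A.le_opNorm y
      _ = _ := by ring

end C1b

section Uniqueness

variable {X : Type*} [NormedAddCommGroup X] [InnerProductSpace ℝ X] [CompleteSpace X]
  [MeasurableSpace X] [BorelSpace X]

lemma IsC1b.measurable {f : X → ℝ} (hf : IsC1b f) : Measurable f := hf.continuous.measurable

lemma IsC1b.integrable_mul [SecondCountableTopology X] {f g : X → ℝ} (hf : IsC1b f) {μ : Measure X}
    (hg : Integrable g μ) : Integrable (fun x => f x * g x) μ := by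
  obtain ⟨C, -, hC, -⟩ := hf.exists_bound
  exact hg.bdd_mul hf.continuous.aestronglyMeasurable (.of_forall hC)

lemma IsC1b.memLp [SecondCountableTopology X] {f : X → ℝ} (hf : IsC1b f) (μ : Measure X)
    [IsFiniteMeasure μ] (p : ℝ≥0∞) : MemLp f p μ := by
  obtain ⟨C, -, hC, -⟩ := hf.exists_bound
  exact MemLp.of_bound hf.continuous.aestronglyMeasurable C (.of_forall hC)

variable [SecondCountableTopology X]

/-- Two finite measures which agree on `C¹_b(X)` are equal: `cos ⟨·, ξ⟩` and `sin ⟨·, ξ⟩` are in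
`C¹_b(X)`, so that the characteristic functions agree. -/
lemma measure_ext_of_isC1b {μ₁ μ₂ : Measure X} [IsFiniteMeasure μ₁] [IsFiniteMeasure μ₂]
    (h : ∀ φ : X → ℝ, IsC1b φ → ∫ x, φ x ∂μ₁ = ∫ x, φ x ∂μ₂) : μ₁ = μ₂ := by
  refine Measure.ext_of_charFun (funext fun ξ => ?_)
  have key : ∀ (μ : Measure X) [IsFiniteMeasure μ], charFun μ ξ
      = (∫ x, Real.cos (inner ℝ x ξ) ∂μ : ℝ) + (∫ x, Real.sin (inner ℝ x ξ) ∂μ : ℝ) * Complex.I := by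
    intro μ _
    have hc : Integrable (fun x => (Real.cos (inner ℝ x ξ) : ℂ)) μ :=
      (memLp_one_iff_integrable.1 ((isC1b_cos_inner ξ).memLp μ 1)).ofReal
    have hs : Integrable (fun x => (Real.sin (inner ℝ x ξ) : ℂ)) μ :=
      (memLp_one_iff_integrable.1 ((isC1b_sin_inner ξ).memLp μ 1)).ofReal
    rw [charFun_apply, ← integral_complex_ofReal, ← integral_complex_ofReal,
      ← integral_mul_const, ← integral_add hc (hs.mul_const _)]
    congr 1
    ext x
    rw [Complex.exp_mul_I]
    simp
  rw [key, key, h _ (isC1b_cos_inner ξ), h _ (isC1b_sin_inner ξ)]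

/-- `C¹_b(X)` separates the points of `L¹(X, μ)`. -/
lemma ae_eq_zero_of_forall_integral_isC1b_mul {μ : Measure X} [IsFiniteMeasure μ] {g : X → ℝ}
    (hg : Integrable g μ) (h : ∀ φ : X → ℝ, IsC1b φ → ∫ x, φ x * g x ∂μ = 0) : g =ᵐ[μ] 0 := by
  have hm : ∀ f : X → ℝ, Integrable f μ →
      IsFiniteMeasure (μ.withDensity fun x => ENNReal.ofReal (f x)) :=
    fun f hf => isFiniteMeasure_withDensity_ofReal hf.2
  have h1 := hm g hg
  have hneg : Integrable (fun x => -g x) μ := hg.neg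
  have h2 := hm _ hneg
  have hint : ∀ f : X → ℝ, Integrable f μ → ∀ φ : X → ℝ,
      ∫ x, φ x ∂(μ.withDensity fun x => ENNReal.ofReal (f x)) = ∫ x, max (f x) 0 * φ x ∂μ := by
    intro f hf φ
    rw [integral_withDensity_eq_integral_toReal_smul₀ hf.aemeasurable.ennreal_ofReal
      (.of_forall fun x => ENNReal.ofReal_lt_top)]
    simp [ENNReal.toReal_ofReal']
  have heq : (μ.withDensity fun x => ENNReal.ofReal (g x))
      = μ.withDensity fun x => ENNReal.ofReal (-g x) := by
    refine measure_ext_of_isC1b fun φ hφ => ?_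
    rw [hint g hg, hint _ hneg, ← sub_eq_zero, ← integral_sub]
    · refine Eq.trans ?_ (h φ hφ)
      congr 1
      ext x
      rcases le_total 0 (g x) with h0 | h0
      · rw [max_eq_left h0, max_eq_right (by linarith)]; ring
      · rw [max_eq_right h0, max_eq_left (by linarith)]; ring
    · simpa [mul_comm] using hφ.integrable_mul hg.pos_part
    · simpa [mul_comm] using hφ.integrable_mul hg.neg_part
  have hae := (withDensity_eq_iff hg.aemeasurable.ennreal_ofReal
    hneg.aemeasurable.ennreal_ofReal (by
      have := h1.measure_univ_lt_top
      rw [withDensity_apply _ .univ, Measure.restrict_univ] at this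
      exact this.ne)).1 heq
  filter_upwards [hae] with x hx
  rcases le_total 0 (g x) with h0 | h0
  · rw [ENNReal.ofReal_of_nonpos (p := -g x) (by linarith)] at hx
    exact le_antisymm (ENNReal.ofReal_eq_zero.1 hx) h0
  · rw [ENNReal.ofReal_of_nonpos h0] at hx
    have := ENNReal.ofReal_eq_zero.1 hx.symm
    exact le_antisymm h0 (by simpa using this)

end Uniqueness

/-! ### The pairing with fields and the supremum `V₀` -/

section Pairing

variable {X : Type*} [NormedAddCommGroup X] [InnerProductSpace ℝ X] [CompleteSpace X]
  [MeasurableSpace X]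

/-- `∫ u ∇^*(f • R z) dν`, where `∇^*(f • R z) = v_z f - ⟨∇f, R z⟩`. -/
noncomputable def pairing (ν : Measure X) (R : X →L[ℝ] X) (v : X → X → ℝ) (u : X → ℝ)
    (f : X → ℝ) (z : X) : ℝ :=
  ∫ x, u x * (v z x * f x - fderiv ℝ f x (R z)) ∂ν

variable [BorelSpace X] [SecondCountableTopology X]
variable {ν : Measure X} {R : X →L[ℝ] X} {v : X → X → ℝ} {u : X → ℝ}

lemma IsC1b.integrable_pairing (hu : Integrable u ν) (huv : ∀ z, Integrable (fun x => u x * v z x) ν)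
    {f : X → ℝ} (hf : IsC1b f) (z : X) :
    Integrable (fun x => u x * (v z x * f x - fderiv ℝ f x (R z))) ν := by
  obtain ⟨C, hC0, hC, hC'⟩ := hf.exists_bound
  have h1 := hf.integrable_mul (huv z)
  have h2 : Integrable (fun x => fderiv ℝ f x (R z) * u x) ν :=
    hu.bdd_mul (c := C * ‖R z‖) (hf.continuous_fderiv_apply _).aestronglyMeasurable
      (.of_forall fun x => (fderiv ℝ f x).le_of_opNorm_le (hC' x) _)
  refine (h1.sub h2).congr (.of_forall fun x => ?_)
  simp only [Pi.sub_apply]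
  ring

lemma pairing_add (hu : Integrable u ν) (huv : ∀ z, Integrable (fun x => u x * v z x) ν)
    {f g : X → ℝ} (hf : IsC1b f) (hg : IsC1b g) (z : X) :
    pairing ν R v u (fun x => f x + g x) z = pairing ν R v u f z + pairing ν R v u g z := by
  rw [pairing, pairing, pairing, ← integral_add (hf.integrable_pairing hu huv z)
    (hg.integrable_pairing hu huv z)]
  congr 1
  ext x
  rw [fderiv_fun_add (hf.differentiable x) (hg.differentiable x)]
  simp only [add_apply]
  ring

lemma pairing_const_mul (c : ℝ) {f : X → ℝ} (hf : IsC1b f) (z : X) :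
    pairing ν R v u (fun x => c * f x) z = c * pairing ν R v u f z := by
  rw [pairing, pairing, ← integral_const_mul]
  congr 1
  ext x
  rw [fderiv_const_mul (hf.differentiable x)]
  simp only [smul_apply, smul_eq_mul]
  ring

lemma continuous_field {n : ℕ} {f : Fin n → X → ℝ} (hf : ∀ i, IsC1b (f i)) (y : Fin n → X) :
    Continuous fun x => ∑ i, f i x • y i :=
  continuous_finsetSum _ fun i _ => (hf i).continuous.smul continuous_const

lemma exists_bound_field {n : ℕ} {f : Fin n → X → ℝ} (hf : ∀ i, IsC1b (f i)) (y : Fin n → X) :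
    ∃ C, ∀ x, ‖∑ i, f i x • y i‖ ≤ C := by
  choose C hC using fun i => (hf i).bounded
  refine ⟨∑ i, C i * ‖y i‖, fun x => (norm_sum_le _ _).trans (Finset.sum_le_sum fun i _ => ?_)⟩
  rw [norm_smul]
  exact mul_le_mul_of_nonneg_right (hC i x) (norm_nonneg _)

/-- Integration by parts along `R z`. -/
lemma IsLogDerivFamily.integral_fderiv (hv : IsLogDerivFamily ν R v) (hR : IsSelfAdjoint R)
    {φ : X → ℝ} (hφ : IsC1b φ) (z : X) :
    ∫ x, fderiv ℝ φ x (R z) ∂ν = ∫ x, v z x * φ x ∂ν := by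
  rw [← hv.integral_eq z φ hφ]
  congr 1
  ext x
  rw [← inner_gradient, hR.isSymmetric.apply_clm]

variable [IsProbabilityMeasure ν]

lemma IsLogDerivFamily.memLp_nablaStar (hv : IsLogDerivFamily ν R v) {q : ℝ≥0∞} (h1 : 1 < q)
    (h2 : q < ∞) {f : X → ℝ} (hf : IsC1b f) (z : X) :
    MemLp (fun x => v z x * f x - fderiv ℝ f x (R z)) q ν := by
  obtain ⟨C, hC0, hC, hC'⟩ := hf.exists_bound
  refine MemLp.sub ?_ ?_
  · exact (hf.memLp ν ∞).mul (hv.memLp z q h1 h2)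
  · exact MemLp.of_bound (hf.continuous_fderiv_apply _).aestronglyMeasurable (C * ‖R z‖)
      (.of_forall fun x => (fderiv ℝ f x).le_of_opNorm_le (hC' x) _)

lemma one_lt_lt_top_of_holderConjugate {p q : ℝ≥0∞} (hp : 1 < p) (hp' : p < ∞)
    (h : p.HolderConjugate q) : 1 < q ∧ q < ∞ :=
  haveI := h.symm
  ⟨(ENNReal.HolderConjugate.lt_top_iff_one_lt p q).1 hp',
    (ENNReal.HolderConjugate.lt_top_iff_one_lt q p).2 hp⟩

/-- The explicit form of `∇^*` on the fields `∑ i, f i • R (z i)`. -/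
lemma IsLogDerivFamily.isNablaStar (hv : IsLogDerivFamily ν R v) (hR : IsSelfAdjoint R)
    {n : ℕ} {f : Fin n → X → ℝ} (hf : ∀ i, IsC1b (f i)) (z : Fin n → X) :
    IsNablaStar ν (fun x => ∑ i, f i x • R (z i))
      fun x => ∑ i, (v (z i) x * f i x - fderiv ℝ (f i) x (R (z i))) := by
  intro p q hp hp' hpq
  obtain ⟨hq, hq'⟩ := one_lt_lt_top_of_holderConjugate hp hp' hpq
  obtain ⟨C, hC⟩ := exists_bound_field hf (fun i => R (z i))
  refine ⟨MemLp.of_bound (continuous_field hf _).aestronglyMeasurable C (.of_forall hC),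
    memLp_finsetSum _ fun i _ => hv.memLp_nablaStar hq hq' (hf i) (z i), fun φ hφ => ?_⟩
  have hI : ∀ i, Integrable (fun x => v (z i) x * f i x - fderiv ℝ (f i) x (R (z i))) ν :=
    fun i => (hv.memLp_nablaStar hq hq' (hf i) (z i)).integrable hq.le
  have hJ : ∀ i, Integrable (fun x => f i x * fderiv ℝ φ x (R (z i))) ν := by
    intro i
    obtain ⟨D, -, -, hD'⟩ := hφ.exists_bound
    refine (hf i).integrable_mul (memLp_one_iff_integrable.1 <| MemLp.of_bound
      (hφ.continuous_fderiv_apply _).aestronglyMeasurable (D * ‖R (z i)‖)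
      (.of_forall fun x => (fderiv ℝ φ x).le_of_opNorm_le (hD' x) _))
  simp only [inner_sum, inner_smul_right, inner_gradient, Finset.mul_sum]
  rw [integral_finsetSum _ fun i _ => hJ i,
    integral_finsetSum _ fun i _ => hφ.integrable_mul (hI i)]
  refine Finset.sum_congr rfl fun i _ => ?_
  have key := hv.integral_fderiv hR (hφ.mul (hf i)) (z i)
  have e1 : ∀ x, fderiv ℝ (fun x => φ x * f i x) x (R (z i))
      = φ x * fderiv ℝ (f i) x (R (z i)) + f i x * fderiv ℝ φ x (R (z i)) := by
    intro x
    rw [fderiv_fun_mul (hφ.differentiable x) ((hf i).differentiable x)]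
    simp
  obtain ⟨D, -, -, hD'⟩ := (hf i).exists_bound
  have hK : Integrable (fun x => φ x * fderiv ℝ (f i) x (R (z i))) ν :=
    hφ.integrable_mul (memLp_one_iff_integrable.1 <| MemLp.of_bound
      ((hf i).continuous_fderiv_apply _).aestronglyMeasurable (D * ‖R (z i)‖)
      (.of_forall fun x => (fderiv ℝ (f i) x).le_of_opNorm_le (hD' x) _))
  have hM : Integrable (fun x => v (z i) x * (φ x * f i x)) ν := by
    refine ((hφ.mul (hf i)).integrable_mul ((hv.memLp (z i) q hq hq').integrable hq.le)).congr
      (.of_forall fun x => ?_)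
    simp only
    ring
  simp only [e1] at key
  rw [integral_add hK (hJ i)] at key
  rw [← sub_eq_iff_eq_add'.2 key.symm, ← integral_sub hM hK]
  congr 1
  ext x
  ring

/-- The image under the adjoint of the gradient is unique. -/
lemma IsNablaStar.ae_eq {F : X → X} {g g' : X → ℝ} (hg : IsNablaStar ν F g)
    (hg' : IsNablaStar ν F g') : g =ᵐ[ν] g' := by
  have h2 : ENNReal.HolderConjugate 2 2 := inferInstance
  have hg := hg 2 2 (by norm_num) (by simp) h2
  have hg' := hg' 2 2 (by norm_num) (by simp) h2
  have hi := hg.memLp_image.integrable one_le_two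
  have hi' := hg'.memLp_image.integrable one_le_two
  have := ae_eq_zero_of_forall_integral_isC1b_mul (hi.sub hi') fun φ hφ => by
    simp only [Pi.sub_apply, mul_sub]
    rw [integral_sub (hφ.integrable_mul hi) (hφ.integrable_mul hi'), ← hg.integral_eq φ hφ,
      ← hg'.integral_eq φ hφ, sub_self]
  filter_upwards [this] with x hx
  exact sub_eq_zero.1 hx

lemma integral_mul_nablaStar (hu : Integrable u ν) (huv : ∀ z, Integrable (fun x => u x * v z x) ν)
    {n : ℕ} {f : Fin n → X → ℝ} (hf : ∀ i, IsC1b (f i)) (z : Fin n → X) :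
    ∫ x, u x * ∑ i, (v (z i) x * f i x - fderiv ℝ (f i) x (R (z i))) ∂ν
      = ∑ i, pairing ν R v u (f i) (z i) := by
  simp only [Finset.mul_sum]
  exact integral_finsetSum _ fun i _ => (hf i).integrable_pairing hu huv (z i)

lemma le_V0 (hv : IsLogDerivFamily ν R v) (hR : IsSelfAdjoint R)
    (hu : Integrable u ν) (huv : ∀ z, Integrable (fun x => u x * v z x) ν)
    {κ : Type*} (s : Finset κ) {f : κ → X → ℝ} (hf : ∀ i ∈ s, IsC1b (f i)) (z : κ → X)
    (h1 : ∀ x, ‖∑ i ∈ s, f i x • R (z i)‖ ≤ 1) :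
    ENNReal.ofReal (∑ i ∈ s, pairing ν R v u (f i) (z i)) ≤ V0 ν R u := by
  have hsum : ∀ a : κ → ℝ, ∑ i ∈ s, a i = ∑ j, a (s.equivFin.symm j) := fun a => by
    rw [← Finset.sum_coe_sort, ← s.equivFin.symm.sum_comp]
  have hsum' : ∀ a : κ → X, ∑ i ∈ s, a i = ∑ j, a (s.equivFin.symm j) := fun a => by
    rw [← Finset.sum_coe_sort, ← s.equivFin.symm.sum_comp]
  have hf' : ∀ j, IsC1b (f (s.equivFin.symm j)) := fun j => hf _ (s.equivFin.symm j).2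
  simp only [hsum'] at h1
  rw [hsum]
  rw [← integral_mul_nablaStar hu huv hf' fun j => z (s.equivFin.symm j)]
  exact le_iSup_of_le _ <| le_iSup_of_le _ <| le_iSup_of_le
    ⟨_, _, fun j => R (z (s.equivFin.symm j)), hf', fun j => ⟨_, rfl⟩, rfl⟩ <| le_iSup_of_le h1 <|
    le_iSup_of_le (hv.isNablaStar hR hf' _) le_rfl

lemma V0_le (hv : IsLogDerivFamily ν R v) (hR : IsSelfAdjoint R)
    (hu : Integrable u ν) (huv : ∀ z, Integrable (fun x => u x * v z x) ν) {C : ℝ≥0∞}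
    (h : ∀ (n : ℕ) (f : Fin n → X → ℝ) (z : Fin n → X), (∀ i, IsC1b (f i)) →
      (∀ x, ‖∑ i, f i x • R (z i)‖ ≤ 1) →
      ENNReal.ofReal (∑ i, pairing ν R v u (f i) (z i)) ≤ C) :
    V0 ν R u ≤ C := by
  refine iSup_le fun F => iSup_le fun g => iSup_le fun ⟨n, f, y, hf, hy, hF⟩ => iSup_le fun h1 =>
    iSup_le fun hg => ?_
  choose z hz using hy
  obtain rfl : (fun i => R (z i)) = y := funext hz
  subst hF
  have hae := hg.ae_eq (hv.isNablaStar hR hf z)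
  rw [integral_congr_ae (hae.mono fun x hx => by rw [hx]), integral_mul_nablaStar hu huv hf z]
  exact h n f z hf h1

/-- Homogeneity: the constant `V0` bounds the pairing with fields which are bounded by `c`. -/
lemma sum_pairing_le (hv : IsLogDerivFamily ν R v) (hR : IsSelfAdjoint R)
    (hu : Integrable u ν) (huv : ∀ z, Integrable (fun x => u x * v z x) ν)
    (hV : V0 ν R u < ∞) {κ : Type*} (s : Finset κ) {f : κ → X → ℝ} (hf : ∀ i ∈ s, IsC1b (f i))
    (z : κ → X) {c : ℝ} (h1 : ∀ x, ‖∑ i ∈ s, f i x • R (z i)‖ ≤ c) :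
    ∑ i ∈ s, pairing ν R v u (f i) (z i) ≤ c * (V0 ν R u).toReal := by
  have hc : 0 ≤ c := (norm_nonneg _).trans (h1 0)
  have hpos : ∀ d : ℝ, c < d → ∑ i ∈ s, pairing ν R v u (f i) (z i) ≤ d * (V0 ν R u).toReal := by
    intro d hd
    have hd0 : 0 < d := hc.trans_lt hd
    have := le_V0 hv hR hu huv s (fun i hi => (hf i hi).const_mul d⁻¹) z fun x => by
      simp only [mul_smul, ← Finset.smul_sum]
      rw [norm_smul, norm_inv, Real.norm_of_nonneg hd0.le, inv_mul_le_iff₀ hd0, mul_one]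
      exact (h1 x).trans hd.le
    rw [Finset.sum_congr rfl fun i hi => pairing_const_mul d⁻¹ (hf i hi) (z i),
      ← Finset.mul_sum] at this
    have := (ENNReal.ofReal_le_iff_le_toReal hV.ne).1 this
    rwa [inv_mul_le_iff₀ hd0] at this
  have hlim : Tendsto (fun d : ℝ => d * (V0 ν R u).toReal) (𝓝[>] c) (𝓝 (c * (V0 ν R u).toReal)) :=
    ((continuous_id.mul continuous_const).tendsto c).mono_left nhdsWithin_le_nhds
  exact ge_of_tendsto hlim (eventually_nhdsWithin_of_forall hpos)

/-- Hölder's inequality; `p > 1` makes the conjugate exponent finite. -/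
lemma IsLogDerivFamily.integrable_mul (hv : IsLogDerivFamily ν R v) {p : ℝ≥0∞} (hp : 1 < p)
    (hu : MemLp u p ν) (z : X) : Integrable (fun x => u x * v z x) ν := by
  -- The exponent is lowered to a finite one, whose conjugate is then finite too.
  have hu' : MemLp u (min p 2) ν := hu.mono_exponent (min_le_left _ _)
  have h1 : 1 < min p 2 := lt_min hp (by norm_num)
  have h2 : min p 2 < ∞ := (min_le_right _ _).trans_lt (by simp)
  have hc : ENNReal.HolderConjugate (min p 2) (ENNReal.conjExponent (min p 2)) :=
    ENNReal.HolderConjugate.conjExponent h1.le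
  obtain ⟨hq, hq'⟩ := one_lt_lt_top_of_holderConjugate h1 h2 hc
  exact hu'.integrable_mul (hv.memLp z _ hq hq')

end Pairing

/-! ### Integrals against vector measures -/

section VectorIntegral

/-- A functional on bounded measurable functions which is additive and continuous along bounded
pointwise limits, such as the integral against a measure of finite variation. -/
structure IsBoundedIntegral {X : Type*} [MeasurableSpace X] (I : (X → ℝ) → ℝ) : Prop where
  add : ∀ f g : SimpleFunc X ℝ, I (⇑f + ⇑g) = I f + I g
  tendsto : ∀ (C : ℝ) (f : ℕ → SimpleFunc X ℝ) (g : X → ℝ), (∀ n x, |f n x| ≤ C) →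
    (∀ x, Tendsto (fun n => f n x) atTop (𝓝 (g x))) → Tendsto (fun n => I (f n)) atTop (𝓝 (I g))

lemma IsBoundedIntegral.eq_of_indicator {X : Type*} [MeasurableSpace X] {I J : (X → ℝ) → ℝ}
    (hI : IsBoundedIntegral I) (hJ : IsBoundedIntegral J)
    (h : ∀ (c : ℝ) (s : Set X), MeasurableSet s →
      I (s.indicator fun _ => c) = J (s.indicator fun _ => c))
    {φ : X → ℝ} (hφm : Measurable φ) {C : ℝ} (hφ : ∀ x, |φ x| ≤ C) : I φ = J φ := by
  have hs : ∀ f : SimpleFunc X ℝ, I f = J f := by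
    intro f
    induction f using SimpleFunc.induction with
    | @const c s hs =>
      have : ⇑(SimpleFunc.piecewise s hs (SimpleFunc.const X c) (SimpleFunc.const X 0))
          = s.indicator fun _ => c := by
        ext x
        by_cases hx : x ∈ s <;> simp [hx]
      rw [this]
      exact h c s hs
    | @add f g _ hf hg =>
      rw [SimpleFunc.coe_add, hI.add, hJ.add, hf, hg]
  have hst : StronglyMeasurable φ := hφm.stronglyMeasurable
  have hb : ∀ n x, |hst.approxBounded C n x| ≤ C := fun n x =>
    hst.norm_approxBounded_le ((abs_nonneg _).trans (hφ x)) n x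
  have ht : ∀ x, Tendsto (fun n => hst.approxBounded C n x) atTop (𝓝 (φ x)) := fun x =>
    hst.tendsto_approxBounded_of_norm_le (hφ x)
  refine tendsto_nhds_unique (hI.tendsto C _ φ hb ht) ?_
  simp only [hs]
  exact hJ.tendsto C _ φ hb ht

variable {X : Type*} [NormedAddCommGroup X] [InnerProductSpace ℝ X] [CompleteSpace X]
  [MeasurableSpace X]

lemma innerMeasure_apply (m : VectorMeasure X X) (y : X) (s : Set X) :
    innerMeasure m y s = inner ℝ y (m s) := rfl

lemma variation_innerMeasure_le (m : VectorMeasure X X) (y : X) :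
    (innerMeasure m y).variation ≤ ‖y‖₊ • m.variation := by
  refine VectorMeasure.variation_le_of_forall_enorm_le fun s _ => ?_
  rw [innerMeasure_apply]
  calc ‖inner ℝ y (m s)‖ₑ ≤ ‖y‖ₑ * ‖m s‖ₑ := by
        rw [← ofReal_norm, ← ofReal_norm, ← ofReal_norm, ← ENNReal.ofReal_mul (norm_nonneg _)]
        exact ENNReal.ofReal_le_ofReal (norm_inner_le_norm _ _)
    _ ≤ ‖y‖ₑ * m.variation s := by gcongr; exact VectorMeasure.enorm_measure_le_variation _ _
    _ = _ := rfl

instance (m : VectorMeasure X X) [IsFiniteMeasure m.variation] (y : X) :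
    IsFiniteMeasure (innerMeasure m y).variation :=
  isFiniteMeasure_of_le _ (variation_innerMeasure_le m y)

/-- Integration of `φ • y` against a vector measure through a bilinear pairing. -/
lemma isBoundedIntegral_vectorIntegral {E F : Type*} [NormedAddCommGroup E] [NormedSpace ℝ E]
    [NormedAddCommGroup F] [NormedSpace ℝ F] (m : VectorMeasure X F) [IsFiniteMeasure m.variation]
    (B : E →L[ℝ] F →L[ℝ] ℝ) (y : E) :
    IsBoundedIntegral fun φ : X → ℝ => VectorMeasure.integral m (fun x => φ x • y) B where
  add f g := by
    have h : ∀ f : SimpleFunc X ℝ, m.Integrable fun x => f x • y := fun f =>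
      (SimpleFunc.integrable_of_isFiniteMeasure f).smul_const y
    rw [← VectorMeasure.integral_fun_add (h f) (h g)]
    simp only [Pi.add_apply, add_smul]
  tendsto C f g hf hg :=
    VectorMeasure.tendsto_integral_filter_of_norm_le_const
      (.of_forall fun n => (f n).stronglyMeasurable.aestronglyMeasurable.smul_const y)
      ⟨C * ‖y‖, .of_forall fun n => .of_forall fun x => by
        rw [norm_smul]
        exact mul_le_mul_of_nonneg_right (hf n x) (norm_nonneg _)⟩
      (.of_forall fun x => (hg x).smul_const y)

lemma isBoundedIntegral_innerMeasure (m : VectorMeasure X X) [IsFiniteMeasure m.variation] (y : X) :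
    IsBoundedIntegral fun φ : X → ℝ =>
      VectorMeasure.integral (innerMeasure m y) φ (ContinuousLinearMap.lsmul ℝ ℝ) := by
  simpa using isBoundedIntegral_vectorIntegral (innerMeasure m y)
    (ContinuousLinearMap.lsmul ℝ ℝ) (1 : ℝ)

lemma integral_innerMeasure_indicator (m : VectorMeasure X X) [IsFiniteMeasure m.variation] (y : X)
    (c : ℝ) {s : Set X} (hs : MeasurableSet s) :
    VectorMeasure.integral (innerMeasure m y) (s.indicator fun _ => c)
      (ContinuousLinearMap.lsmul ℝ ℝ) = c * inner ℝ y (m s) := by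
  rw [VectorMeasure.integral_indicator_const c hs]
  rfl

/-- The integral against `⟨m, y⟩` is the integral of the field `φ • y` against `m`. -/
lemma integral_innerMeasure (m : VectorMeasure X X) [IsFiniteMeasure m.variation] (y : X)
    {φ : X → ℝ} (hφm : Measurable φ) {C : ℝ} (hφ : ∀ x, |φ x| ≤ C) :
    VectorMeasure.integral (innerMeasure m y) φ (ContinuousLinearMap.lsmul ℝ ℝ)
      = VectorMeasure.integral m (fun x => φ x • y) (innerSL ℝ) := by
  refine (isBoundedIntegral_innerMeasure m y).eq_of_indicator
    (isBoundedIntegral_vectorIntegral m (innerSL ℝ) y) (fun c s hs => ?_) hφm hφ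
  have : (fun x => s.indicator (fun _ => c) x • y) = s.indicator fun _ => c • y := by
    ext x
    by_cases hx : x ∈ s <;> simp [hx]
  rw [integral_innerMeasure_indicator m y c hs, this, VectorMeasure.integral_indicator_const _ hs,
    map_smul]
  rfl

lemma integral_innerSL_le (m : VectorMeasure X X) [IsFiniteMeasure m.variation]
    {F : X → X} (hF : ∀ x, ‖F x‖ ≤ 1) :
    VectorMeasure.integral m F (innerSL ℝ) ≤ m.variation.real univ := by
  refine (Real.le_norm_self _).trans ((VectorMeasure.norm_integral_le_of_norm_le_const
    (.of_forall hF)).trans ?_)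
  rw [one_mul]
  exact mul_le_of_le_one_left measureReal_nonneg (norm_innerSL_le ℝ)

lemma variation_withDensityᵥ_lt_top {μ : Measure X} {ρ : X → X} (hρ : Integrable ρ μ) :
    (μ.withDensityᵥ ρ).variation univ < ∞ := by
  rw [Measure.variation_withDensityᵥ hρ, withDensity_apply _ .univ, Measure.restrict_univ]
  exact hρ.2

/-- The integral against `⟨ρ μ, y⟩`. -/
lemma integral_innerMeasure_withDensityᵥ {μ : Measure X} {ρ : X → X} (hρ : Integrable ρ μ) (y : X)
    {φ : X → ℝ} (hφm : Measurable φ) {C : ℝ} (hφ : ∀ x, |φ x| ≤ C) :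
    VectorMeasure.integral (innerMeasure (μ.withDensityᵥ ρ) y) φ (ContinuousLinearMap.lsmul ℝ ℝ)
      = ∫ x, φ x * inner ℝ y (ρ x) ∂μ := by
  have : IsFiniteMeasure (μ.withDensityᵥ ρ).variation := ⟨variation_withDensityᵥ_lt_top hρ⟩
  have hi : Integrable (fun x => inner ℝ y (ρ x)) μ := hρ.const_inner y
  have hI : ∀ (f : X → ℝ) (C : ℝ), AEStronglyMeasurable f μ → (∀ x, |f x| ≤ C) →
      Integrable (fun x => f x * inner ℝ y (ρ x)) μ := fun f C hf hC =>
    hi.bdd_mul hf (.of_forall hC)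
  have hs : ∀ f : SimpleFunc X ℝ, Integrable (fun x => f x * inner ℝ y (ρ x)) μ := fun f => by
    obtain ⟨C, hC⟩ := f.exists_forall_norm_le
    exact hI f C f.stronglyMeasurable.aestronglyMeasurable hC
  refine (isBoundedIntegral_innerMeasure _ y).eq_of_indicator
    (J := fun φ => ∫ x, φ x * inner ℝ y (ρ x) ∂μ) ⟨fun f g => ?_, fun C f g hf hg => ?_⟩
    (fun c s hs => ?_) hφm hφ
  · rw [← integral_add (hs f) (hs g)]
    simp only [Pi.add_apply, add_mul]
  · refine tendsto_integral_of_dominated_convergence (fun x => C * |inner ℝ y (ρ x)|)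
      (fun n => (hs (f n)).aestronglyMeasurable) (hi.abs.const_mul C) (fun n => .of_forall fun x => ?_)
      (.of_forall fun x => (hg x).mul_const _)
    rw [Real.norm_eq_abs, abs_mul]
    exact mul_le_mul_of_nonneg_right (hf n x) (abs_nonneg _)
  · rw [integral_innerMeasure_indicator _ y c hs, withDensityᵥ_apply hρ hs,
      ← integral_inner hρ.integrableOn, ← integral_const_mul, ← integral_indicator hs]
    congr 1
    ext x
    by_cases hx : x ∈ s <;> simp [hx]

end VectorIntegral

/-! ### Density of `C¹_b(X)` and truncation of fields -/

section Density

variable {X : Type*} [NormedAddCommGroup X] [InnerProductSpace ℝ X] [CompleteSpace X]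

/-- The orthogonal complement of the range is the kernel of the adjoint. -/
lemma dense_range_of_isSelfAdjoint {R : X →L[ℝ] X} (hR : IsSelfAdjoint R)
    (hinj : Function.Injective R) : DenseRange R := by
  have h : (R.range)ᗮ = ⊥ := by
    rw [ContinuousLinearMap.orthogonal_range, hR.adjoint_eq]
    exact LinearMap.ker_eq_bot.2 hinj
  have := Submodule.dense_iff_topologicalClosure_eq_top.2
    ((Submodule.topologicalClosure_eq_top_iff).2 h)
  rwa [LinearMap.coe_range] at this

/-- The norm of `a` is nearly attained by pairing `a` with a vector of the range which is a unit
vector or `0`; these are the vectors fixed by the truncation below. -/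
lemma exists_unit_range_inner_ge {R : X →L[ℝ] X} (hR : DenseRange R) (a : X) {ε : ℝ} (hε : 0 < ε) :
    ∃ z, (‖R z‖ = 1 ∨ R z = 0) ∧ ‖a‖ - ε ≤ inner ℝ (R z) a := by
  rcases eq_or_ne a 0 with rfl | ha
  · exact ⟨0, Or.inr (map_zero R), by simpa using hε.le⟩
  have hcont : ContinuousAt (fun y : X => ‖y‖⁻¹ * inner ℝ y a) a :=
    (continuousAt_id.norm.inv₀ (norm_ne_zero_iff.2 ha)).mul
      (continuousAt_id.inner continuousAt_const)
  have hval : ‖a‖⁻¹ * inner ℝ a a = ‖a‖ := by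
    rw [real_inner_self_eq_norm_sq, sq, inv_mul_cancel_left₀ (norm_ne_zero_iff.2 ha)]
  have hev : ∀ᶠ y in 𝓝 a, ‖a‖ - ε < ‖y‖⁻¹ * inner ℝ y a ∧ y ≠ 0 :=
    (hcont.eventually_const_lt (by simp only; rw [hval]; linarith)).and (eventually_ne_nhds ha)
  obtain ⟨y, ⟨z, rfl⟩, hy, hy0⟩ := 
    ((mem_closure_iff_frequently.1 (hR a)).and_eventually hev).exists
  refine ⟨‖R z‖⁻¹ • z, Or.inl ?_, ?_⟩
  · rw [map_smul, norm_smul, norm_inv, norm_norm, inv_mul_cancel₀ (norm_ne_zero_iff.2 hy0)]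
  · rw [map_smul, inner_smul_left]
    simpa using hy.le

/-- The truncation `y ↦ 2 y / (1 + ‖y‖²)` maps `X` into the unit ball. -/
lemma norm_truncation_le (y : X) : ‖(2 * (1 + ‖y‖ ^ 2)⁻¹) • y‖ ≤ 1 := by
  rw [norm_smul, Real.norm_of_nonneg (by positivity), mul_right_comm, ← div_eq_mul_inv,
    div_le_one (by positivity)]
  nlinarith [sq_nonneg (‖y‖ - 1)]

/-- The truncation `y ↦ 2 y / (1 + ‖y‖²)` fixes `0` and the unit vectors, and it is Lipschitz
there. -/
lemma norm_truncation_sub_le {y w : X} (hw : ‖w‖ = 1 ∨ w = 0) :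
    ‖(2 * (1 + ‖y‖ ^ 2)⁻¹) • y - w‖ ≤ 4 * ‖y - w‖ := by
  have hpos : 0 < 1 + ‖y‖ ^ 2 := by positivity
  have hle : (1 + ‖y‖ ^ 2)⁻¹ ≤ 1 := inv_le_one_of_one_le₀ (by nlinarith [sq_nonneg ‖y‖])
  rcases hw with hw | rfl
  · set s := 2 * (1 + ‖y‖ ^ 2)⁻¹ with hs
    have e : s • y - w = s • (y - w) + (s - 1) • w := by
      rw [smul_sub, sub_smul, one_smul]; abel
    have h1 : |s - 1| ≤ 2 * ‖y - w‖ := by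
      have e2 : s - 1 = (1 - ‖y‖) * (1 + ‖y‖) * (1 + ‖y‖ ^ 2)⁻¹ := by
        rw [hs]; field_simp; ring
      have h2 : (1 + ‖y‖) * (1 + ‖y‖ ^ 2)⁻¹ ≤ 2 := by
        rw [← div_eq_mul_inv, div_le_iff₀ hpos]
        nlinarith [sq_nonneg (‖y‖ - 1), norm_nonneg y, sq_nonneg ‖y‖]
      have h3 : |1 - ‖y‖| ≤ ‖y - w‖ := by
        rw [← hw, abs_sub_comm]; exact abs_norm_sub_norm_le y w
      rw [e2, mul_assoc, abs_mul, abs_of_nonneg (a := (1 + ‖y‖) * (1 + ‖y‖ ^ 2)⁻¹) (by positivity)]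
      nlinarith [abs_nonneg (1 - ‖y‖)]
    rw [e]
    refine (norm_add_le _ _).trans ?_
    rw [norm_smul, norm_smul, hw, Real.norm_of_nonneg (by positivity), Real.norm_eq_abs]
    nlinarith [norm_nonneg (y - w)]
  · rw [sub_zero, sub_zero, norm_smul, Real.norm_of_nonneg (by positivity)]
    nlinarith [norm_nonneg y, mul_le_mul_of_nonneg_right hle (norm_nonneg y)]

variable [MeasurableSpace X] [BorelSpace X] [SecondCountableTopology X]

/-- The functions of `C¹_b(X)`, as a subspace of `L²(X, μ)`. -/
noncomputable def c1bLp (μ : Measure X) [IsFiniteMeasure μ] : Submodule ℝ (Lp ℝ 2 μ) where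
  carrier := {g | ∃ (f : X → ℝ) (hf : IsC1b f), (hf.memLp μ 2).toLp f = g}
  zero_mem' := ⟨fun _ => 0, isC1b_const 0, MemLp.toLp_zero _⟩
  add_mem' := by
    rintro _ _ ⟨f, hf, rfl⟩ ⟨g, hg, rfl⟩
    exact ⟨fun x => f x + g x, hf.add hg, MemLp.toLp_add (hf.memLp μ 2) (hg.memLp μ 2)⟩
  smul_mem' := by
    rintro c _ ⟨f, hf, rfl⟩
    exact ⟨fun x => c * f x, hf.const_mul c, MemLp.toLp_const_smul c (hf.memLp μ 2)⟩

/-- Density in `L²` is separation of points, by orthogonality. -/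
lemma topologicalClosure_c1bLp (μ : Measure X) [IsFiniteMeasure μ] :
    (c1bLp μ).topologicalClosure = ⊤ := by
  rw [Submodule.topologicalClosure_eq_top_iff, eq_bot_iff]
  intro g hg
  rw [Submodule.mem_orthogonal] at hg
  have h0 := ae_eq_zero_of_forall_integral_isC1b_mul (μ := μ) (g := g)
    ((Lp.memLp g).integrable one_le_two) fun φ hφ => by
      rw [← hg _ ⟨φ, hφ, rfl⟩, L2.inner_def]
      refine integral_congr_ae ?_
      filter_upwards [(hφ.memLp μ 2).coeFn_toLp] with x hx
      rw [hx]
      simp [mul_comm]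
  exact (Submodule.mem_bot ℝ).2 ((Lp.eq_zero_iff_ae_eq_zero).2 h0)

/-- The `L¹` norm is bounded by the `L²` norm, with some constant. -/
lemma exists_integral_norm_le_eLpNorm_two {α E : Type*} [MeasurableSpace α] [NormedAddCommGroup E]
    (μ : Measure α) [IsFiniteMeasure μ] :
    ∃ K : ℝ, 0 < K ∧ ∀ f : α → E, MemLp f 2 μ → ∫ x, ‖f x‖ ∂μ ≤ K * (eLpNorm f 2 μ).toReal := by
  set K := (μ univ ^ (1 / (1 : ℝ≥0∞).toReal - 1 / (2 : ℝ≥0∞).toReal)).toReal with hK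
  have hK0 : 0 ≤ K := ENNReal.toReal_nonneg
  refine ⟨K + 1, by positivity, fun f hf => ?_⟩
  have hle := eLpNorm_le_eLpNorm_mul_rpow_measure_univ (μ := μ) one_le_two hf.aestronglyMeasurable
  have hfin : μ univ ^ (1 / (1 : ℝ≥0∞).toReal - 1 / (2 : ℝ≥0∞).toReal) ≠ ∞ :=
    ENNReal.rpow_ne_top_of_nonneg (by norm_num) (measure_ne_top _ _)
  have := ENNReal.toReal_mono (ENNReal.mul_ne_top hf.eLpNorm_ne_top hfin) hle
  rw [ENNReal.toReal_mul, ← hK, eLpNorm_one_eq_lintegral_enorm,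
    ← integral_norm_eq_lintegral_enorm hf.aestronglyMeasurable, mul_comm] at this
  refine this.trans (mul_le_mul_of_nonneg_right (by linarith) ENNReal.toReal_nonneg)

lemma exists_isC1b_integral_abs_sub_indicator_le (μ : Measure X) [IsFiniteMeasure μ] {s : Set X}
    (hs : MeasurableSet s) {ε : ℝ} (hε : 0 < ε) :
    ∃ f : X → ℝ, IsC1b f ∧ ∫ x, |f x - s.indicator (fun _ => (1 : ℝ)) x| ∂μ ≤ ε := by
  have h1 : MemLp (s.indicator fun _ => (1 : ℝ)) 2 μ := (memLp_const 1).indicator hs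
  have hmem : h1.toLp _ ∈ closure (c1bLp μ : Set (Lp ℝ 2 μ)) := by
    rw [← Submodule.topologicalClosure_coe, topologicalClosure_c1bLp]
    trivial
  obtain ⟨K, hK, hle⟩ := exists_integral_norm_le_eLpNorm_two (E := ℝ) μ
  obtain ⟨_, ⟨f, hf, rfl⟩, hd⟩ := Metric.mem_closure_iff.1 hmem (ε / K) (by positivity)
  refine ⟨f, hf, (hle _ ((hf.memLp μ 2).sub h1)).trans ?_⟩
  rw [dist_comm, dist_eq_norm, ← MemLp.toLp_sub, Lp.norm_toLp, lt_div_iff₀ hK, mul_comm] at hd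
  exact hd.le

end Density

/-! ### The total variation equals `V₀` -/

section TotalVariation

variable {X : Type*} [NormedAddCommGroup X] [InnerProductSpace ℝ X] [CompleteSpace X]
  [MeasurableSpace X] [BorelSpace X] [SecondCountableTopology X]
variable {ν : Measure X} {R : X →L[ℝ] X} {v : X → X → ℝ} {u : X → ℝ} {m : VectorMeasure X X}

lemma IsBV0Measure.isFiniteMeasure (h : IsBV0Measure ν R v u m) : IsFiniteMeasure m.variation :=
  ⟨h.variation_lt_top⟩

lemma IsC1b.integrable_smul_variation [IsFiniteMeasure m.variation] {f : X → ℝ} (hf : IsC1b f)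
    (y : X) : m.Integrable fun x => f x • y :=
  (memLp_one_iff_integrable.1 (hf.memLp _ 1)).smul_const y

/-- The defining identity of `BV₀`, for fields: the pairing is the integral against `m`. -/
lemma IsBV0Measure.sum_pairing_eq (h : IsBV0Measure ν R v u m) {κ : Type*} (s : Finset κ)
    {f : κ → X → ℝ} (hf : ∀ i ∈ s, IsC1b (f i)) (z : κ → X) :
    ∑ i ∈ s, pairing ν R v u (f i) (z i)
      = VectorMeasure.integral m (fun x => ∑ i ∈ s, f i x • R (z i)) (innerSL ℝ) := by
  have := h.isFiniteMeasure
  rw [VectorMeasure.integral_finsetSum s fun i hi => (hf i hi).integrable_smul_variation _]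
  refine Finset.sum_congr rfl fun i hi => ?_
  obtain ⟨C, hC⟩ := (hf i hi).bounded
  rw [← integral_innerMeasure m _ (hf i hi).measurable hC, ← neg_inj,
    ← h.integral_eq _ _ rfl _ (hf i hi), pairing, ← integral_neg]
  congr 1
  ext x
  rw [inner_gradient]
  ring

variable [IsProbabilityMeasure ν]

lemma IsBV0Measure.V0_le_variation (hv : IsLogDerivFamily ν R v) (hR : IsSelfAdjoint R)
    (hu : Integrable u ν) (huv : ∀ z, Integrable (fun x => u x * v z x) ν)
    (h : IsBV0Measure ν R v u m) : V0 ν R u ≤ m.variation univ := by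
  have := h.isFiniteMeasure
  refine V0_le hv hR hu huv fun n f z hf h1 => ?_
  rw [h.sum_pairing_eq Finset.univ (fun i _ => hf i) z]
  refine ENNReal.ofReal_le_of_le_toReal (integral_innerSL_le m h1)

/-- Vector fields of `C¹_b` class approximate in `L¹` the step fields which nearly realize the
total variation; the truncation `y ↦ 2 y / (1 + ‖y‖²)` keeps them in the unit ball. -/
lemma IsBV0Measure.sum_norm_le (hv : IsLogDerivFamily ν R v) (hR : IsSelfAdjoint R)
    (hinj : Function.Injective R)
    (hu : Integrable u ν) (huv : ∀ z, Integrable (fun x => u x * v z x) ν)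
    (h : IsBV0Measure ν R v u m) (hV : V0 ν R u < ∞) {P : Finset (Set X)}
    (hd : (P : Set (Set X)).PairwiseDisjoint id) (hP : ∀ s ∈ P, MeasurableSet s) :
    ∑ s ∈ P, ‖m s‖ ≤ (V0 ν R u).toReal := by
  have := h.isFiniteMeasure
  have key : ∀ ε : ℝ, 0 < ε → ∑ s ∈ P, ‖m s‖ ≤ (V0 ν R u).toReal + (5 * P.card) * ε := by
    intro ε hε
    choose z hz1 hz2 using fun s : Set X =>
      exists_unit_range_inner_ge (dense_range_of_isSelfAdjoint hR hinj) (m s) hε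
    have hRz : ∀ s, ‖R (z s)‖ ≤ 1 := fun s => by
      rcases hz1 s with h | h
      · exact h.le
      · simp [h]
    choose! f hf hfε using fun (s : Set X) (hs : s ∈ P) =>
      exists_isC1b_integral_abs_sub_indicator_le m.variation (hP s hs) hε
    -- `G` is the field before truncation and `F₀` is the step field.
    set G : X → X := fun x => ∑ s ∈ P, f s x • R (z s) with hG
    set F₀ : X → X := fun x => ∑ s ∈ P, s.indicator (fun _ => R (z s)) x with hF₀
    have hF₀norm : ∀ x, ‖F₀ x‖ = 1 ∨ F₀ x = 0 := by
      intro x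
      by_cases hx : ∃ s ∈ P, x ∈ s
      · obtain ⟨s, hs, hxs⟩ := hx
        have : F₀ x = R (z s) := by
          rw [hF₀]
          simp only
          rw [Finset.sum_eq_single s]
          · simp [hxs]
          · intro t ht hts
            refine indicator_of_notMem (fun hxt => ?_) _
            exact (Set.disjoint_left.1 (hd ht hs hts)) hxt hxs
          · exact fun hs' => absurd hs hs'
        rw [this]
        exact hz1 s
      · right
        refine Finset.sum_eq_zero fun s hs => indicator_of_notMem (fun hxs => hx ⟨s, hs, hxs⟩) _
    set θ : X → ℝ := fun x => 2 * (1 + ‖G x‖ ^ 2)⁻¹ with hθ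
    -- The factor `2 / (1 + ‖G‖²)` is in `C¹_b`: `‖G‖²` is a polynomial in the `f s`.
    have hθC : IsC1b θ := by
      have e : ∀ x, 1 + ‖G x‖ ^ 2
          = 1 + ∑ s ∈ P, ∑ t ∈ P, (f s x * f t x) * inner ℝ (R (z s)) (R (z t)) := by
        intro x
        rw [← real_inner_self_eq_norm_sq, hG]
        simp only [sum_inner, inner_sum, real_inner_smul_left, real_inner_smul_right]
        congr 1
        refine Finset.sum_congr rfl fun s _ => Finset.sum_congr rfl fun t _ => ?_
        rw [real_inner_comm]
        ring
      have h1 : IsC1b fun x => 1 + ‖G x‖ ^ 2 := by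
        simp only [e]
        refine (isC1b_const 1).add (.sum _ fun s hs => .sum _ fun t ht => ?_)
        exact ((hf s hs).mul (hf t ht)).mul (isC1b_const _)
      exact (h1.inv one_pos fun x => by nlinarith [sq_nonneg ‖G x‖]).const_mul 2
    have hFC : ∀ s ∈ P, IsC1b fun x => θ x * f s x := fun s hs => hθC.mul (hf s hs)
    have hFG : ∀ x, ∑ s ∈ P, (θ x * f s x) • R (z s) = θ x • G x := fun x => by
      rw [hG, Finset.smul_sum]
      simp only [mul_smul]
    have hle := (sum_pairing_le hv hR hu huv hV P hFC z (c := 1) fun x => by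
      rw [hFG]; exact norm_truncation_le (G x))
    rw [h.sum_pairing_eq P hFC z, one_mul] at hle
    have hIF : m.Integrable fun x => ∑ s ∈ P, (θ x * f s x) • R (z s) :=
      integrable_finsetSum _ fun s hs => (hFC s hs).integrable_smul_variation _
    have hI0s : ∀ s ∈ P, m.Integrable fun x => s.indicator (fun _ => R (z s)) x := fun s hs =>
      (integrable_const (R (z s))).indicator (hP s hs)
    have hI0 : m.Integrable F₀ := integrable_finsetSum _ hI0s
    have h0 : VectorMeasure.integral m F₀ (innerSL ℝ) = ∑ s ∈ P, inner ℝ (R (z s)) (m s) := by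
      rw [hF₀, VectorMeasure.integral_finsetSum _ hI0s]
      refine Finset.sum_congr rfl fun s hs => ?_
      rw [VectorMeasure.integral_indicator_const _ (hP s hs)]
      rfl
    -- The truncation fixes the values of `F₀`, so that it costs only a factor `4` in `L¹`.
    have hdiff : VectorMeasure.integral m F₀ (innerSL ℝ)
        - VectorMeasure.integral m (fun x => ∑ s ∈ P, (θ x * f s x) • R (z s)) (innerSL ℝ)
        ≤ 4 * (P.card * ε) := by
      rw [← VectorMeasure.integral_fun_sub hI0 hIF]
      refine (Real.le_norm_self _).trans (VectorMeasure.norm_integral_le_integral_norm.trans ?_)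
      refine (mul_le_of_le_one_left (integral_nonneg fun _ => norm_nonneg _)
        (norm_innerSL_le ℝ)).trans ?_
      have hIs : ∀ s ∈ P, Integrable (fun x => |f s x - s.indicator (fun _ => (1 : ℝ)) x|)
          m.variation := fun s hs =>
        ((memLp_one_iff_integrable.1 ((hf s hs).memLp _ 1)).sub
          ((integrable_const (1 : ℝ)).indicator (hP s hs))).abs
      calc ∫ x, ‖F₀ x - ∑ s ∈ P, (θ x * f s x) • R (z s)‖ ∂m.variation
          ≤ ∫ x, 4 * ∑ s ∈ P, |f s x - s.indicator (fun _ => (1 : ℝ)) x| ∂m.variation := by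
            refine integral_mono (hI0.sub hIF).norm
              ((integrable_finsetSum _ hIs).const_mul 4) fun x => ?_
            simp only
            rw [hFG, norm_sub_rev]
            refine (norm_truncation_sub_le (hF₀norm x)).trans ?_
            refine mul_le_mul_of_nonneg_left ?_ (by norm_num)
            rw [hG, hF₀]
            simp only
            rw [← Finset.sum_sub_distrib]
            refine (norm_sum_le _ _).trans (Finset.sum_le_sum fun s _ => ?_)
            have : s.indicator (fun _ => R (z s)) x
                = s.indicator (fun _ => (1 : ℝ)) x • R (z s) := by
              by_cases hx : x ∈ s <;> simp [hx]
            rw [this, ← sub_smul, norm_smul]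
            exact mul_le_of_le_one_right (norm_nonneg _) (hRz s)
        _ = 4 * ∑ s ∈ P, ∫ x, |f s x - s.indicator (fun _ => (1 : ℝ)) x| ∂m.variation := by
            rw [integral_const_mul, integral_finsetSum _ hIs]
        _ ≤ 4 * (P.card * ε) := by
            rw [← nsmul_eq_mul]
            exact mul_le_mul_of_nonneg_left (Finset.sum_le_card_nsmul _ _ _ hfε) (by norm_num)
    have hlow : ∑ s ∈ P, ‖m s‖ - P.card * ε ≤ ∑ s ∈ P, inner ℝ (R (z s)) (m s) := by
      have := Finset.sum_le_sum fun s (_ : s ∈ P) => hz2 s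
      rwa [Finset.sum_sub_distrib, Finset.sum_const, nsmul_eq_mul] at this
    rw [h0] at hdiff
    linarith
  refine le_of_forall_pos_le_add fun δ hδ => ?_
  have hc : (0 : ℝ) < 5 * P.card + 1 := by positivity
  refine (key (δ / (5 * P.card + 1)) (by positivity)).trans ?_
  have : 5 * (P.card : ℝ) * (δ / (5 * P.card + 1)) ≤ δ := by
    rw [mul_div_assoc', div_le_iff₀ hc]
    nlinarith
  linarith

lemma IsBV0Measure.variation_eq (hv : IsLogDerivFamily ν R v) (hR : IsSelfAdjoint R)
    (hinj : Function.Injective R)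
    (hu : Integrable u ν) (huv : ∀ z, Integrable (fun x => u x * v z x) ν)
    (h : IsBV0Measure ν R v u m) : m.variation univ = V0 ν R u := by
  have hV : V0 ν R u < ∞ := (h.V0_le_variation hv hR hu huv).trans_lt h.variation_lt_top
  refine le_antisymm (le_of_forall_lt fun a ha => ?_) (h.V0_le_variation hv hR hu huv)
  obtain ⟨P, -, hd, hP, hlt⟩ := m.exists_lt_sum_of_lt_variation .univ ha
  refine hlt.trans_le ?_
  have e : ∑ s ∈ P, ‖m s‖ₑ = ENNReal.ofReal (∑ s ∈ P, ‖m s‖) := by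
    rw [ENNReal.ofReal_sum_of_nonneg fun _ _ => norm_nonneg _]
    simp only [ofReal_norm]
  rw [e]
  exact ENNReal.ofReal_le_of_le_toReal (h.sum_norm_le hv hR hinj hu huv hV hd hP)

end TotalVariation

/-! ### Functionals dominated by a sublinear map into `C(K)` -/

section Representation

open scoped CompactlySupported in
/-- The Riesz-Markov-Kakutani theorem on a compact space. -/
lemma exists_measure_of_positive {K : Type*} [TopologicalSpace K] [CompactSpace K] [T2Space K]
    [MeasurableSpace K] [BorelSpace K] (l : C(K, ℝ) →ₗ[ℝ] ℝ) (hl : ∀ f, 0 ≤ f → 0 ≤ l f) :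
    ∃ μ : Measure K, IsFiniteMeasure μ ∧ ∀ f : C(K, ℝ), ∫ k, f k ∂μ = l f := by
  let T : C_c(K, ℝ) →ₗ[ℝ] C(K, ℝ) :=
    { toFun := fun f => f.toContinuousMap
      map_add' := fun _ _ => rfl
      map_smul' := fun _ _ => rfl }
  let Λ : C_c(K, ℝ) →ₚ[ℝ] ℝ := PositiveLinearMap.mk₀ (l.comp T) fun f hf => hl _ hf
  refine ⟨RealRMK.rieszMeasure Λ, ⟨isCompact_univ.measure_lt_top⟩, fun f => ?_⟩
  exact RealRMK.integral_rieszMeasure Λ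
    (CompactlySupportedContinuousMap.continuousMapEquiv f)

/-- A linear functional `L` dominated by the supremum of a sublinear map `N` with values in `C(K)`
is dominated by the integral of `N` against some measure. The measure comes from the positive
functionals on `C(K) × V` for the cone `{(f, a) | N a ≤ f}`. -/
theorem exists_measure_le_integral {K : Type*} [TopologicalSpace K] [CompactSpace K] [T2Space K]
    [Nonempty K] [MeasurableSpace K] [BorelSpace K] {V : Type*} [AddCommGroup V] [Module ℝ V]
    (N : V → C(K, ℝ)) (hadd : ∀ a b k, N (a + b) k ≤ N a k + N b k)
    (hsmul : ∀ (c : ℝ) a k, 0 ≤ c → N (c • a) k = c * N a k) (L : V →ₗ[ℝ] ℝ) (C : ℝ)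
    (hL : ∀ a c, (∀ k, N a k ≤ c) → L a ≤ c * C) :
    ∃ μ : Measure K, IsFiniteMeasure μ ∧ μ.real univ = C ∧ ∀ a, L a ≤ ∫ k, N a k ∂μ := by
  let s : PointedCone ℝ (C(K, ℝ) × V) :=
    { carrier := {x | ∀ k, N x.2 k ≤ x.1 k}
      zero_mem' := fun k => by simpa using (hsmul 0 0 k le_rfl).le
      add_mem' := fun {x y} hx hy k => (hadd _ _ k).trans (add_le_add (hx k) (hy k))
      smul_mem' := fun c x hx k => by
        have := mul_le_mul_of_nonneg_left (hx k) c.2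
        calc N ((c : ℝ) • x.2) k = c * N x.2 k := hsmul _ _ k c.2
          _ ≤ c * x.1 k := this }
  obtain ⟨k₀⟩ := ‹Nonempty K›
  -- The functional to be extended is `(c, a) ↦ c C - L a`, on the constant functions times `V`.
  let D : Submodule ℝ (C(K, ℝ) × V) :=
    (Submodule.span ℝ {(1 : C(K, ℝ))}).comap (LinearMap.fst ℝ _ _)
  let ev : C(K, ℝ) →ₗ[ℝ] ℝ :=
    { toFun := fun f => f k₀
      map_add' := fun _ _ => rfl
      map_smul' := fun _ _ => rfl }
  let f : (C(K, ℝ) × V) →ₗ.[ℝ] ℝ :=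
    ⟨D, (C • ev.comp (LinearMap.fst ℝ _ _) - L.comp (LinearMap.snd ℝ _ _)).domRestrict D⟩
  have hf : ∀ x : f.domain, f x = C * (x : C(K, ℝ) × V).1 k₀ - L (x : C(K, ℝ) × V).2 :=
    fun x => rfl
  have hD : ∀ (c : ℝ) (a : V), (c • (1 : C(K, ℝ)), a) ∈ f.domain := fun c a =>
    Submodule.mem_span_singleton.2 ⟨c, rfl⟩
  obtain ⟨g, hg, hgs⟩ := riesz_extension s f (fun x hx => by
    obtain ⟨⟨φ, a⟩, hxD⟩ := x
    obtain ⟨c, hc⟩ := Submodule.mem_span_singleton.1 hxD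
    obtain rfl : c • (1 : C(K, ℝ)) = φ := hc
    have h1 := hL a c fun k => by simpa using hx k
    rw [hf]
    simp only [ContinuousMap.coe_smul, ContinuousMap.coe_one, Pi.smul_apply, Pi.one_apply,
      smul_eq_mul, mul_one]
    linarith) fun y => by
      refine ⟨⟨((‖N y.2‖ + ‖y.1‖) • 1, 0), hD _ _⟩, fun k => ?_⟩
      have h1 := (Real.le_norm_self _).trans ((N y.2).norm_coe_le_norm k)
      have h2 := (neg_le_of_abs_le (a := y.1 k) ((y.1).norm_coe_le_norm k))
      simp only [Prod.snd_add, zero_add, Prod.fst_add, ContinuousMap.add_apply,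
        ContinuousMap.smul_apply, ContinuousMap.one_apply, smul_eq_mul, mul_one]
      linarith
  obtain ⟨μ, hμ, hint⟩ := exists_measure_of_positive (g.comp (LinearMap.inl ℝ _ V)) fun φ hφ => by
    refine hgs (φ, 0) fun k => ?_
    have : N (0 : V) k = 0 := by simpa using hsmul 0 0 k le_rfl
    simp only [this]
    exact hφ k
  refine ⟨μ, hμ, ?_, fun a => ?_⟩
  · have h1 := hint 1
    have h2 := hg ⟨_, hD 1 0⟩
    rw [hf] at h2
    simp only [one_smul, ContinuousMap.coe_one, Pi.one_apply, mul_one, map_zero, sub_zero] at h2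
    have h3 : ∫ k, (1 : C(K, ℝ)) k ∂μ = μ.real univ := by simp
    rw [← h3, h1, ← h2]
    rfl
  · rw [hint]
    have h1 := hgs (N a, a) fun k => le_rfl
    have h2 := hg ⟨_, hD 0 a⟩
    rw [hf] at h2
    have e : (N a, a) = LinearMap.inl ℝ C(K, ℝ) V (N a) + ((0 : ℝ) • (1 : C(K, ℝ)), a) := by simp
    rw [e, map_add, h2] at h1
    simp only [zero_smul, ContinuousMap.zero_apply, mul_zero, zero_sub] at h1
    rw [LinearMap.comp_apply]
    linarith

end Representation

/-! ### Gaussian cut-offs and their extension to `ι → [-∞, ∞]` -/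

section Cutoff

variable {X : Type*} [NormedAddCommGroup X] [InnerProductSpace ℝ X] [CompleteSpace X]
variable {ι : Type*} (h : HilbertBasis ι ℝ X)

lemma countable_of_hilbertBasis [SecondCountableTopology X] (h : HilbertBasis ι ℝ X) : Countable ι := by
  have hd : (univ : Set ι).PairwiseDisjoint fun i => Metric.ball (h i) (1 / 2) := by
    intro i _ j _ hij
    refine Metric.ball_disjoint_ball ?_
    have h1 : ‖h i - h j‖ ^ 2 = 2 := by
      rw [norm_sub_sq_real, h.orthonormal.1, h.orthonormal.1, h.orthonormal.2 hij]
      norm_num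
    rw [dist_eq_norm]
    nlinarith [norm_nonneg (h i - h j)]
  exact countable_univ_iff.1 (hd.countable_of_isOpen (fun _ _ => Metric.isOpen_ball)
    fun i _ => ⟨h i, Metric.mem_ball_self (by norm_num)⟩)

/-- The orthogonal projection on the span of finitely many vectors of a Hilbert basis. -/
noncomputable def proj (S : Finset ι) : X →L[ℝ] X :=
  ∑ i ∈ S, (innerSL ℝ (h i)).smulRight (h i)

lemma proj_apply (S : Finset ι) (x : X) : proj h S x = ∑ i ∈ S, (inner ℝ (h i) x : ℝ) • h i := by
  simp [proj]

lemma norm_sum_smul_sq (S : Finset ι) (c : ι → ℝ) : ‖∑ i ∈ S, c i • h i‖ ^ 2 = ∑ i ∈ S, c i ^ 2 := by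
  rw [← real_inner_self_eq_norm_sq, h.orthonormal.inner_sum]
  simp [sq]

lemma norm_proj_le (S : Finset ι) (x : X) : ‖proj h S x‖ ≤ ‖x‖ := by
  refine abs_le_of_sq_le_sq' ?_ (norm_nonneg _) |>.2
  rw [proj_apply, norm_sum_smul_sq]
  simpa using h.orthonormal.sum_inner_products_le (s := S) x

lemma tendsto_proj (x : X) : Tendsto (fun S => proj h S x) atTop (𝓝 x) := by
  simp only [proj_apply, ← h.repr_apply_apply]
  exact h.hasSum_repr x

/-- The function `f`, made cylindrical by a finite-dimensional projection and multiplied with a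
Gaussian cut-off. -/
noncomputable def cutoff (f : X → ℝ) (t : ℝ) (S : Finset ι) (x : X) : ℝ :=
  f (proj h S x) * Real.exp (-t * ‖proj h S x‖ ^ 2)

lemma IsC1b.cutoff {f : X → ℝ} (hf : IsC1b f) {t : ℝ} (ht : 0 < t) (S : Finset ι) :
    IsC1b (cutoff h f t S) :=
  (hf.comp_clm (proj h S)).mul (isC1b_gauss ht (proj h S))

lemma exp_neg_mul_sq_le_one {t : ℝ} (ht : 0 ≤ t) (r : ℝ) : Real.exp (-t * r ^ 2) ≤ 1 :=
  Real.exp_le_one_iff.2 (by nlinarith [sq_nonneg r])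

lemma abs_cutoff_le {f : X → ℝ} {C : ℝ} (hC : ∀ x, |f x| ≤ C) {t : ℝ} (ht : 0 ≤ t) (S : Finset ι)
    (x : X) : |cutoff h f t S x| ≤ C := by
  rw [BVHilbert.cutoff, abs_mul, Real.abs_exp]
  exact (mul_le_of_le_one_right (abs_nonneg _) (exp_neg_mul_sq_le_one ht _)).trans (hC _)

lemma fderiv_cutoff_apply {f : X → ℝ} (hf : IsC1b f) {t : ℝ} (ht : 0 < t) (S : Finset ι) (x y : X) :
    fderiv ℝ (cutoff h f t S) x y
      = f (proj h S x) * fderiv ℝ (fun x => Real.exp (-t * ‖proj h S x‖ ^ 2)) x y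
        + Real.exp (-t * ‖proj h S x‖ ^ 2) * fderiv ℝ f (proj h S x) (proj h S y) := by
  have := fderiv_fun_mul ((hf.comp_clm (proj h S)).differentiable x)
    ((isC1b_gauss ht (proj h S)).differentiable x)
  change fderiv ℝ (fun x => f (proj h S x) * Real.exp (-t * ‖proj h S x‖ ^ 2)) x y = _
  rw [this, add_apply, smul_apply, smul_apply, fderiv_comp_clm hf]
  rfl

lemma abs_fderiv_cutoff_apply_le {f : X → ℝ} (hf : IsC1b f) {C : ℝ} (hC : ∀ x, |f x| ≤ C)
    (hC' : ∀ x, ‖fderiv ℝ f x‖ ≤ C) {t : ℝ} (ht : 0 < t) (ht1 : t ≤ 1) (S : Finset ι) (x y : X) :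
    |fderiv ℝ (cutoff h f t S) x y| ≤ 3 * C * ‖y‖ := by
  have hC0 : 0 ≤ C := (abs_nonneg _).trans (hC 0)
  rw [fderiv_cutoff_apply h hf ht]
  have h1 : |f (proj h S x) * fderiv ℝ (fun x => Real.exp (-t * ‖proj h S x‖ ^ 2)) x y|
      ≤ C * (2 * 1 * ‖y‖) := by
    rw [abs_mul]
    refine mul_le_mul (hC _) ((abs_fderiv_gauss_apply_le ht _ _ _).trans ?_) (abs_nonneg _) hC0
    gcongr
    · exact Real.sqrt_le_one.2 ht1
    · exact norm_proj_le h S y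
  have h2 : |Real.exp (-t * ‖proj h S x‖ ^ 2) * fderiv ℝ f (proj h S x) (proj h S y)|
      ≤ 1 * (C * ‖y‖) := by
    rw [abs_mul, Real.abs_exp]
    refine mul_le_mul (exp_neg_mul_sq_le_one ht.le _) ?_ (abs_nonneg _) one_pos.le
    exact ((fderiv ℝ f _).le_of_opNorm_le (hC' _) _).trans
      (mul_le_mul_of_nonneg_left (norm_proj_le h S y) hC0)
  refine (abs_add_le _ _).trans ((add_le_add h1 h2).trans (le_of_eq ?_))
  ring

lemma tendsto_exp_cutoff (x : X) : Tendsto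
    (fun p : ℝ × Finset ι => Real.exp (-p.1 * ‖proj h p.2 x‖ ^ 2)) (𝓝[>] 0 ×ˢ atTop) (𝓝 1) := by
  have h1 : Tendsto (fun p : ℝ × Finset ι => p.1) (𝓝[>] 0 ×ˢ atTop) (𝓝 0) :=
    tendsto_fst.mono_right nhdsWithin_le_nhds
  have h2 : Tendsto (fun p : ℝ × Finset ι => proj h p.2 x) (𝓝[>] 0 ×ˢ atTop) (𝓝 x) :=
    (tendsto_proj h x).comp tendsto_snd
  have := (h1.neg.mul (h2.norm.pow 2)).rexp
  simpa using this

lemma tendsto_cutoff {f : X → ℝ} (hf : Continuous f) (x : X) : Tendsto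
    (fun p : ℝ × Finset ι => cutoff h f p.1 p.2 x) (𝓝[>] 0 ×ˢ atTop) (𝓝 (f x)) := by
  have h2 : Tendsto (fun p : ℝ × Finset ι => proj h p.2 x) (𝓝[>] 0 ×ˢ atTop) (𝓝 x) :=
    (tendsto_proj h x).comp tendsto_snd
  have := ((hf.tendsto x).comp h2).mul (tendsto_exp_cutoff h x)
  rwa [mul_one] at this

lemma eventually_mem_Ioc : ∀ᶠ p : ℝ × Finset ι in 𝓝[>] 0 ×ˢ atTop, p.1 ∈ Ioc (0 : ℝ) 1 :=
  tendsto_fst.eventually (Ioc_mem_nhdsGT one_pos)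

lemma tendsto_fderiv_cutoff {f : X → ℝ} (hf : IsC1b f) (x y : X) : Tendsto
    (fun p : ℝ × Finset ι => fderiv ℝ (cutoff h f p.1 p.2) x y) (𝓝[>] 0 ×ˢ atTop)
    (𝓝 (fderiv ℝ f x y)) := by
  obtain ⟨C, hC0, hC, hC'⟩ := hf.exists_bound
  have hp : ∀ x, Tendsto (fun p : ℝ × Finset ι => proj h p.2 x) (𝓝[>] 0 ×ˢ atTop) (𝓝 x) :=
    fun x => (tendsto_proj h x).comp tendsto_snd
  have h1 : Tendsto (fun p : ℝ × Finset ι => f (proj h p.2 x) *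
      fderiv ℝ (fun x => Real.exp (-p.1 * ‖proj h p.2 x‖ ^ 2)) x y) (𝓝[>] 0 ×ˢ atTop) (𝓝 0) := by
    have hlim : Tendsto (fun p : ℝ × Finset ι => C * (2 * √p.1 * ‖y‖)) (𝓝[>] 0 ×ˢ atTop) (𝓝 0) := by
      have h0 : Tendsto (fun p : ℝ × Finset ι => p.1) (𝓝[>] 0 ×ˢ atTop) (𝓝 0) :=
        tendsto_fst.mono_right nhdsWithin_le_nhds
      simpa using ((h0.sqrt.const_mul 2).mul_const ‖y‖).const_mul C
    refine squeeze_zero_norm' ?_ hlim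
    filter_upwards [eventually_mem_Ioc] with p hp
    rw [Real.norm_eq_abs, abs_mul]
    refine mul_le_mul (hC _) ((abs_fderiv_gauss_apply_le hp.1 _ _ _).trans ?_) (abs_nonneg _) hC0
    gcongr
    exact norm_proj_le h _ y
  have h2 : Tendsto (fun p : ℝ × Finset ι => fderiv ℝ f (proj h p.2 x) (proj h p.2 y))
      (𝓝[>] 0 ×ˢ atTop) (𝓝 (fderiv ℝ f x y)) := by
    have h4 : Tendsto (fun p : ℝ × Finset ι => fderiv ℝ f (proj h p.2 x))
        (𝓝[>] 0 ×ˢ atTop) (𝓝 (fderiv ℝ f x)) :=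
      ((hf.contDiff.continuous_fderiv one_ne_zero).tendsto x).comp (hp x)
    exact (isBoundedBilinearMap_apply.continuous.tendsto (fderiv ℝ f x, y)).comp
      (h4.prodMk_nhds (hp y))
  have h3 := h1.add ((tendsto_exp_cutoff h x).mul h2)
  rw [zero_add, one_mul] at h3
  refine h3.congr' ?_
  filter_upwards [eventually_mem_Ioc] with p hp
  rw [fderiv_cutoff_apply h hf hp.1]

variable [MeasurableSpace X] [BorelSpace X] [SecondCountableTopology X]
variable {ν : Measure X} {R : X →L[ℝ] X} {v : X → X → ℝ} {u : X → ℝ}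

/-- The Gaussian cut-offs have gradients of size `O(√t)`, so that the pairing passes to the
limit. -/
lemma tendsto_pairing_cutoff (hu : Integrable u ν)
    (huv : ∀ z, Integrable (fun x => u x * v z x) ν) {f : X → ℝ} (hf : IsC1b f) (z : X) :
    Tendsto (fun p : ℝ × Finset ι => pairing ν R v u (cutoff h f p.1 p.2) z) (𝓝[>] 0 ×ˢ atTop)
      (𝓝 (pairing ν R v u f z)) := by
  have := countable_of_hilbertBasis h
  obtain ⟨C, hC0, hC, hC'⟩ := hf.exists_bound
  refine tendsto_integral_filter_of_dominated_convergence
    (fun x => C * |u x * v z x| + (3 * C * ‖R z‖) * |u x|) ?_ ?_ ?_ ?_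
  · filter_upwards [eventually_mem_Ioc] with p hp
    exact ((hf.cutoff h hp.1 p.2).integrable_pairing hu huv z).aestronglyMeasurable
  · filter_upwards [eventually_mem_Ioc] with p hp
    refine .of_forall fun x => ?_
    rw [mul_sub, Real.norm_eq_abs, ← mul_assoc]
    refine (abs_sub _ _).trans (add_le_add ?_ ?_)
    · rw [abs_mul, mul_comm]
      exact mul_le_mul_of_nonneg_right (abs_cutoff_le h hC hp.1.le _ _) (abs_nonneg _)
    · rw [abs_mul, mul_comm]
      exact mul_le_mul_of_nonneg_right (abs_fderiv_cutoff_apply_le h hf hC hC' hp.1 hp.2 _ _ _)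
        (abs_nonneg _)
  · exact ((huv z).abs.const_mul C).add (hu.abs.const_mul _)
  · exact .of_forall fun x => (((tendsto_cutoff h hf.continuous x).const_mul (v z x)).sub
      (tendsto_fderiv_cutoff h hf x (R z))).const_mul (u x)

end Cutoff

section Extension

/-- The function `exp (-t x²)`, extended by `0` to `±∞`. -/
noncomputable def gaussE (t : ℝ) (k : EReal) : ℝ :=
  if k = ⊤ ∨ k = ⊥ then 0 else Real.exp (-t * k.toReal ^ 2)

lemma gaussE_coe (t r : ℝ) : gaussE t r = Real.exp (-t * r ^ 2) := by
  simp [gaussE]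

lemma gaussE_nonneg (t : ℝ) (k : EReal) : 0 ≤ gaussE t k := by
  unfold gaussE; split_ifs <;> positivity

lemma gaussE_le_one {t : ℝ} (ht : 0 ≤ t) (k : EReal) : gaussE t k ≤ 1 := by
  unfold gaussE
  split_ifs
  · exact zero_le_one
  · exact exp_neg_mul_sq_le_one ht _

lemma tendsto_exp_neg_mul_sq {t : ℝ} (ht : 0 < t) {α : Type*} {l : Filter α} {g : α → ℝ}
    (hg : Tendsto (fun a => g a ^ 2) l atTop) :
    Tendsto (fun a => Real.exp (-t * g a ^ 2)) l (𝓝 0) :=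
  Real.tendsto_exp_atBot.comp (hg.const_mul_atTop_of_neg (neg_lt_zero.2 ht))

lemma continuous_gaussE {t : ℝ} (ht : 0 < t) : Continuous (gaussE t) := by
  rw [continuous_iff_continuousAt]
  intro k
  by_cases hk : k = ⊤ ∨ k = ⊥
  · rw [continuousAt_iff_punctured_nhds]
    have h0 : gaussE t k = 0 := by simp [gaussE, hk]
    rw [h0]
    have hsq : Tendsto (fun k : EReal => k.toReal ^ 2) (𝓝[≠] k) atTop := by
      rcases hk with rfl | rfl
      · exact (tendsto_pow_atTop two_ne_zero).comp EReal.tendsto_toReal_atTop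
      · simpa [Function.comp_def] using ((tendsto_pow_atTop two_ne_zero).comp
          tendsto_abs_atBot_atTop).comp EReal.tendsto_toReal_atBot
    refine squeeze_zero (fun _ => gaussE_nonneg _ _) (fun k => ?_) (tendsto_exp_neg_mul_sq ht hsq)
    unfold gaussE
    split_ifs <;> first | positivity | exact le_rfl
  · push Not at hk
    have hev : gaussE t =ᶠ[𝓝 k] fun k => Real.exp (-t * k.toReal ^ 2) := by
      filter_upwards [eventually_ne_nhds hk.1, eventually_ne_nhds hk.2] with j h1 h2
      simp [gaussE, h1, h2]
    refine ContinuousAt.congr ?_ hev.symm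
    exact (((EReal.tendsto_toReal hk.1 hk.2).pow 2).const_mul (-t)).rexp

variable {X : Type*} [NormedAddCommGroup X] [InnerProductSpace ℝ X] [CompleteSpace X]
variable {ι : Type*} (h : HilbertBasis ι ℝ X)

/-- The coordinate map from `X` to the compact space `ι → [-∞, ∞]`. -/
noncomputable def coordE (x : X) (i : ι) : EReal := ((inner ℝ (h i) x : ℝ) : EReal)

/-- The extension of `cutoff h f t S` from `X` to `ι → [-∞, ∞]`. -/
noncomputable def cutoffE (f : X → ℝ) (t : ℝ) (S : Finset ι) (k : ι → EReal) : ℝ :=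
  f (∑ i ∈ S, (k i).toReal • h i) * ∏ i ∈ S, gaussE t (k i)

lemma prod_gaussE_of_finite (t : ℝ) (S : Finset ι) {k : ι → EReal}
    (hk : ∀ i ∈ S, k i ≠ ⊤ ∧ k i ≠ ⊥) :
    ∏ i ∈ S, gaussE t (k i) = Real.exp (-t * ∑ i ∈ S, (k i).toReal ^ 2) := by
  rw [Finset.mul_sum, Real.exp_sum]
  refine Finset.prod_congr rfl fun i hi => ?_
  simp [gaussE, hk i hi]

lemma cutoffE_coordE (f : X → ℝ) (t : ℝ) (S : Finset ι) (x : X) :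
    cutoffE h f t S (coordE h x) = cutoff h f t S x := by
  rw [cutoffE, prod_gaussE_of_finite t S (by simp [coordE]), cutoff, proj_apply, norm_sum_smul_sq]
  simp [coordE]

/-- Where some coordinate `i ∈ S` is infinite, `f` may oscillate, but the Gaussian factor tends to
`0`. -/
lemma continuous_cutoffE {f : X → ℝ} (hf : Continuous f) {C : ℝ} (hC : ∀ x, |f x| ≤ C) {t : ℝ}
    (ht : 0 < t) (S : Finset ι) : Continuous (cutoffE h f t S) := by
  have hprod : Continuous fun k : ι → EReal => ∏ i ∈ S, gaussE t (k i) :=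
    continuous_finsetProd _ fun i _ => (continuous_gaussE ht).comp (continuous_apply i)
  rw [continuous_iff_continuousAt]
  intro k
  by_cases hk : ∀ i ∈ S, k i ≠ ⊤ ∧ k i ≠ ⊥
  · refine ContinuousAt.mul (hf.continuousAt.comp ?_) hprod.continuousAt
    refine tendsto_finsetSum _ fun i hi => Tendsto.smul_const ?_ _
    exact (EReal.tendsto_toReal (hk i hi).1 (hk i hi).2).comp (continuous_apply i).continuousAt
  · push Not at hk
    obtain ⟨i, hi, hki⟩ := hk
    have h0 : ∏ i ∈ S, gaussE t (k i) = 0 := by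
      refine Finset.prod_eq_zero hi ?_
      rw [gaussE, if_pos]
      by_cases h : k i = ⊤
      · exact Or.inl h
      · exact Or.inr (hki h)
    have h1 := (hprod.tendsto k)
    rw [h0] at h1
    have hv : cutoffE h f t S k = 0 := by rw [cutoffE, h0, mul_zero]
    rw [ContinuousAt, hv]
    refine squeeze_zero_norm (a := fun k => C * ∏ i ∈ S, gaussE t (k i)) (fun k => ?_)
      (by simpa using h1.const_mul C)
    rw [cutoffE, norm_mul, Real.norm_eq_abs,
      Real.norm_of_nonneg (Finset.prod_nonneg fun i _ => gaussE_nonneg _ _)]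
    exact mul_le_mul_of_nonneg_right (hC _) (Finset.prod_nonneg fun i _ => gaussE_nonneg _ _)

end Extension

/-! ### The dominating measure on `ι → [-∞, ∞]` -/

section Compactification

variable {X : Type*} [NormedAddCommGroup X] [InnerProductSpace ℝ X] [CompleteSpace X]
variable {ι : Type*} (h : HilbertBasis ι ℝ X)

/-- The continuous functions on `ι → [-∞, ∞]` which restrict to functions of `C¹_b(X)`. -/
noncomputable def c1bE : Submodule ℝ C(ι → EReal, ℝ) where
  carrier := {a | IsC1b fun x => a (coordE h x)}
  zero_mem' := isC1b_const 0
  add_mem' := fun ha hb => IsC1b.add ha hb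
  smul_mem' := fun c _ ha => IsC1b.const_mul ha c

variable [MeasurableSpace X] [BorelSpace X] [SecondCountableTopology X]
variable {ν : Measure X} {R : X →L[ℝ] X} {v : X → X → ℝ} {u : X → ℝ} [IsProbabilityMeasure ν]

/-- The pairing with fields which extend to `ι → [-∞, ∞]` is dominated by a measure there. -/
lemma exists_measure_compactification [Countable ι] (hv : IsLogDerivFamily ν R v)
    (hR : IsSelfAdjoint R) (hu : Integrable u ν)
    (huv : ∀ z, Integrable (fun x => u x * v z x) ν) (hV : V0 ν R u < ∞) :
    ∃ μ : Measure (ι → EReal), IsFiniteMeasure μ ∧ μ.real univ = (V0 ν R u).toReal ∧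
      ∀ (n : ℕ) (a : Fin n → C(ι → EReal, ℝ)) (z : Fin n → X),
        (∀ i, IsC1b fun x => a i (coordE h x)) →
        ∑ i, pairing ν R v u (fun x => a i (coordE h x)) (z i)
          ≤ ∫ k, ‖∑ i, a i k • R (z i)‖ ∂μ := by
  classical
  -- Formal fields: `Finsupp.single z a` stands for the field `a • R z`.
  let Φ : (X →₀ c1bE h) →ₗ[ℝ] C(ι → EReal, X) := Finsupp.lsum ℝ fun z =>
    { toFun := fun a => ⟨fun k => (a : C(ι → EReal, ℝ)) k • R z,
        (a : C(ι → EReal, ℝ)).continuous.smul continuous_const⟩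
      map_add' := fun a b => by ext k; simp [add_smul]
      map_smul' := fun c a => by ext k; simp [mul_smul] }
  let Λ : (X →₀ c1bE h) →ₗ[ℝ] ℝ := Finsupp.lsum ℝ fun z =>
    { toFun := fun a => pairing ν R v u (fun x => (a : C(ι → EReal, ℝ)) (coordE h x)) z
      map_add' := fun a b => pairing_add hu huv a.2 b.2 z
      map_smul' := fun c a => pairing_const_mul c a.2 z }
  have hΦ : ∀ a k, Φ a k = ∑ z ∈ a.support, (a z : C(ι → EReal, ℝ)) k • R z := by
    intro a k
    simp only [Φ, Finsupp.lsum_apply, Finsupp.sum, ContinuousMap.sum_apply]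
    rfl
  have hΛ : ∀ a, Λ a = ∑ z ∈ a.support,
      pairing ν R v u (fun x => (a z : C(ι → EReal, ℝ)) (coordE h x)) z := fun a => rfl
  let N : (X →₀ c1bE h) → C(ι → EReal, ℝ) := fun a => ⟨fun k => ‖Φ a k‖, (Φ a).continuous.norm⟩
  have hN : ∀ a k, N a k = ‖Φ a k‖ := fun _ _ => rfl
  obtain ⟨μ, hμ, hmass, hle⟩ := exists_measure_le_integral N
    (fun a b k => by
      simp only [hN, map_add, ContinuousMap.add_apply]
      exact norm_add_le _ _)
    (fun c a k hc => by
      simp only [hN, map_smul, ContinuousMap.smul_apply, norm_smul, Real.norm_of_nonneg hc])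
    Λ (V0 ν R u).toReal (fun a c hc => by
      rw [hΛ]
      refine sum_pairing_le hv hR hu huv hV a.support (fun z _ => (a z).2) (fun z => z) fun x => ?_
      have := hc (coordE h x)
      rwa [hN, hΦ] at this)
  refine ⟨μ, hμ, hmass, fun n a z ha => ?_⟩
  have := hle (∑ i, Finsupp.single (z i) (⟨a i, ha i⟩ : c1bE h))
  have e1 : Λ (∑ i, Finsupp.single (z i) (⟨a i, ha i⟩ : c1bE h))
      = ∑ i, pairing ν R v u (fun x => a i (coordE h x)) (z i) := by
    rw [map_sum]
    refine Finset.sum_congr rfl fun i _ => ?_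
    simp only [Λ, Finsupp.lsum_single]
    rfl
  have e2 : ∀ k, N (∑ i, Finsupp.single (z i) (⟨a i, ha i⟩ : c1bE h)) k
      = ‖∑ i, a i k • R (z i)‖ := by
    intro k
    rw [hN, map_sum, ContinuousMap.sum_apply]
    congr 1
    refine Finset.sum_congr rfl fun i _ => ?_
    simp only [Φ, Finsupp.lsum_single]
    rfl
  rw [e1] at this
  simpa only [e2] using this

/-- The points of `ι → [-∞, ∞]` which are the coordinates of a point of `X`. -/
def squareSummable (ι : Type*) : Set (ι → EReal) :=
  {k | (∀ i, k i ≠ ⊤ ∧ k i ≠ ⊥) ∧ ∑' i, ENNReal.ofReal ((k i).toReal ^ 2) ≠ ∞}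

lemma measurableSet_squareSummable [Countable ι] : MeasurableSet (squareSummable ι) := by
  have hm : Measurable fun k : ι → EReal => ∑' i, ENNReal.ofReal ((k i).toReal ^ 2) :=
    Measurable.tsum fun i =>
      ((measurable_ereal_toReal.comp (measurable_pi_apply i)).pow_const 2).ennreal_ofReal
  have e : squareSummable ι = (⋂ i, (Function.eval i ⁻¹' {⊤})ᶜ ∩ (Function.eval i ⁻¹' {⊥})ᶜ) ∩
      ((fun k : ι → EReal => ∑' i, ENNReal.ofReal ((k i).toReal ^ 2)) ⁻¹' {∞})ᶜ := by
    ext k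
    simp [squareSummable]
  rw [e]
  exact (MeasurableSet.iInter fun i =>
    (measurable_pi_apply i (measurableSet_singleton ⊤)).compl.inter
      (measurable_pi_apply i (measurableSet_singleton ⊥)).compl).inter
    (hm (measurableSet_singleton ∞)).compl

lemma tendsto_prod_gaussE {t : ℝ} (ht : 0 < t) {k : ι → EReal} (hk : k ∉ squareSummable ι) :
    Tendsto (fun S : Finset ι => ∏ i ∈ S, gaussE t (k i)) atTop (𝓝 0) := by
  by_cases hfin : ∀ i, k i ≠ ⊤ ∧ k i ≠ ⊥
  · have htop : ∑' i, ENNReal.ofReal ((k i).toReal ^ 2) = ∞ := by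
      by_contra hne
      exact hk ⟨hfin, hne⟩
    simp only [prod_gaussE_of_finite t _ fun i _ => hfin i]
    refine Real.tendsto_exp_atBot.comp (Tendsto.const_mul_atTop_of_neg (neg_lt_zero.2 ht) ?_)
    rw [← ENNReal.tendsto_ofReal_nhds_top]
    have h1 := (ENNReal.summable (f := fun i => ENNReal.ofReal ((k i).toReal ^ 2))).hasSum
    rw [htop] at h1
    refine Tendsto.congr (fun S => ?_) h1
    rw [ENNReal.ofReal_sum_of_nonneg fun i _ => sq_nonneg _]
  · push Not at hfin
    obtain ⟨i, hi⟩ := hfin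
    refine tendsto_const_nhds.congr' ?_
    filter_upwards [eventually_ge_atTop ({i} : Finset ι)] with S hS
    refine (Finset.prod_eq_zero (hS (Finset.mem_singleton_self i)) ?_).symm
    rw [gaussE, if_pos]
    by_cases h : k i = ⊤
    · exact Or.inl h
    · exact Or.inr (hi h)

lemma continuous_prod_gaussE {t : ℝ} (ht : 0 < t) (S : Finset ι) :
    Continuous fun k : ι → EReal => ∏ i ∈ S, gaussE t (k i) :=
  continuous_finsetProd _ fun i _ => (continuous_gaussE ht).comp (continuous_apply i)

lemma prod_gaussE_nonneg (t : ℝ) (S : Finset ι) (k : ι → EReal) : 0 ≤ ∏ i ∈ S, gaussE t (k i) :=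
  Finset.prod_nonneg fun _ _ => gaussE_nonneg _ _

lemma prod_gaussE_le_one {t : ℝ} (ht : 0 ≤ t) (S : Finset ι) (k : ι → EReal) :
    ∏ i ∈ S, gaussE t (k i) ≤ 1 :=
  Finset.prod_le_one (fun _ _ => gaussE_nonneg _ _) fun _ _ => gaussE_le_one ht _

lemma integrable_prod_gaussE [Countable ι] {μ : Measure (ι → EReal)} [IsFiniteMeasure μ] {t : ℝ}
    (ht : 0 < t) (S : Finset ι) : Integrable (fun k => ∏ i ∈ S, gaussE t (k i)) μ :=
  .of_bound (continuous_prod_gaussE ht S).aestronglyMeasurable 1 <| .of_forall fun k => by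
    rw [Real.norm_of_nonneg (prod_gaussE_nonneg t S k)]
    exact prod_gaussE_le_one ht.le S k

/-- The mass of a measure on `ι → [-∞, ∞]` outside of `X` is lost by the Gaussian cut-offs. -/
lemma le_measureReal_squareSummable [Countable ι] {μ : Measure (ι → EReal)} [IsFiniteMeasure μ]
    {t : ℝ} (ht : 0 < t) {c : ℝ}
    (hc : ∀ᶠ S : Finset ι in atTop, c ≤ ∫ k, ∏ i ∈ S, gaussE t (k i) ∂μ) :
    c ≤ μ.real (squareSummable ι) := by
  have hm := measurableSet_squareSummable (ι := ι)
  have hlim : Tendsto (fun S : Finset ι => μ.real (squareSummable ι)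
      + ∫ k in (squareSummable ι)ᶜ, ∏ i ∈ S, gaussE t (k i) ∂μ) atTop
      (𝓝 (μ.real (squareSummable ι) + ∫ _k in (squareSummable ι)ᶜ, (0 : ℝ) ∂μ)) := by
    refine tendsto_const_nhds.add (tendsto_integral_filter_of_dominated_convergence (fun _ => 1)
      (.of_forall fun S => (continuous_prod_gaussE ht S).aestronglyMeasurable)
      (.of_forall fun S => .of_forall fun k => ?_) (integrable_const _) ?_)
    · rw [Real.norm_of_nonneg (prod_gaussE_nonneg t S k)]
      exact prod_gaussE_le_one ht.le S k
    · filter_upwards [ae_restrict_mem hm.compl] with k hk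
      exact tendsto_prod_gaussE ht hk
  rw [integral_zero, add_zero] at hlim
  refine ge_of_tendsto hlim (hc.mono fun S hS => hS.trans ?_)
  rw [← integral_add_compl hm (integrable_prod_gaussE ht S)]
  gcongr
  calc ∫ k in squareSummable ι, ∏ i ∈ S, gaussE t (k i) ∂μ
      ≤ ∫ _k in squareSummable ι, (1 : ℝ) ∂μ :=
        integral_mono (integrable_prod_gaussE ht S).integrableOn (integrable_const _)
          fun k => prod_gaussE_le_one ht.le S k
    _ = μ.real (squareSummable ι) := by simp

open Classical in
/-- The point of `X` with given coordinates; it is `0` if they are not square summable. -/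
noncomputable def ofCoordE (k : ι → EReal) : X :=
  if hk : Summable fun i => (k i).toReal ^ 2 then
    h.repr.symm ⟨fun i => (k i).toReal, memℓp_gen (by simpa using hk)⟩
  else 0

lemma summable_of_mem_squareSummable {k : ι → EReal} (hk : k ∈ squareSummable ι) :
    Summable fun i => (k i).toReal ^ 2 := by
  refine (ENNReal.summable_toReal hk.2).congr fun i => ?_
  rw [ENNReal.toReal_ofReal (sq_nonneg _)]

lemma coordE_ofCoordE {k : ι → EReal} (hk : k ∈ squareSummable ι) : coordE h (ofCoordE h k) = k := by
  ext i
  rw [coordE, ofCoordE, dif_pos (summable_of_mem_squareSummable hk), ← h.repr_apply_apply,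
    LinearIsometryEquiv.apply_symm_apply]
  exact EReal.coe_toReal (hk.1 i).1 (hk.1 i).2

lemma measurable_indicator_ofCoordE [Countable ι] :
    Measurable ((squareSummable ι).indicator (ofCoordE h)) := by
  refine measurable_of_tendsto_metrizable' (atTop : Filter (Finset ι))
    (f := fun S => (squareSummable ι).indicator fun k => ∑ i ∈ S, (k i).toReal • h i)
    (fun S => Measurable.indicator (Finset.measurable_fun_sum _ fun i _ =>
      (measurable_ereal_toReal.comp (measurable_pi_apply i)).smul_const _)
        measurableSet_squareSummable) ?_
  refine tendsto_pi_nhds.2 fun k => ?_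
  by_cases hk : k ∈ squareSummable ι
  · simp only [indicator_of_mem hk]
    rw [ofCoordE, dif_pos (summable_of_mem_squareSummable hk)]
    exact h.hasSum_repr_symm _
  · simp only [indicator_of_notMem hk]
    exact tendsto_const_nhds

end Compactification

/-! ### Existence of the measure -/

section Existence

/-- A linear functional which is bounded by the norm of `T` is represented by a vector. -/
lemma exists_inner_eq_of_le_norm {V H : Type*} [AddCommGroup V] [Module ℝ V]
    [NormedAddCommGroup H] [InnerProductSpace ℝ H] [CompleteSpace H] (T : V →ₗ[ℝ] H)
    (L : V →ₗ[ℝ] ℝ) (C : ℝ) (hL : ∀ a, L a ≤ C * ‖T a‖) : ∃ w : H, ∀ a, L a = inner ℝ w (T a) := by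
  have habs : ∀ a, |L a| ≤ C * ‖T a‖ := fun a =>
    abs_le.2 ⟨by have := hL (-a); simp only [map_neg, norm_neg] at this; linarith, hL a⟩
  have hker : LinearMap.ker T ≤ LinearMap.ker L := fun a ha => by
    have := habs a
    rw [LinearMap.mem_ker.1 ha, norm_zero, mul_zero] at this
    exact LinearMap.mem_ker.2 (abs_nonpos_iff.1 this)
  let l₀ : LinearMap.range T →ₗ[ℝ] ℝ :=
    ((LinearMap.ker T).liftQ L hker).comp T.quotKerEquivRange.symm.toLinearMap
  have hl₀ : ∀ a, l₀ ⟨T a, LinearMap.mem_range_self T a⟩ = L a := fun a => by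
    have : T.quotKerEquivRange.symm ⟨T a, LinearMap.mem_range_self T a⟩
        = (LinearMap.ker T).mkQ a := T.quotKerEquivRange_symm_apply_image a _
    simp only [l₀, LinearMap.comp_apply, LinearEquiv.coe_coe, this]
    exact Submodule.liftQ_apply _ _ _
  obtain ⟨g, hg, -⟩ := exists_extension_norm_eq (LinearMap.range T)
    (l₀.mkContinuous C fun x => by
      obtain ⟨_, a, rfl⟩ := x
      rw [hl₀]
      exact habs a)
  refine ⟨(InnerProductSpace.toDual ℝ H).symm g, fun a => ?_⟩
  rw [InnerProductSpace.toDual_symm_apply, ← hl₀ a]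
  exact (hg ⟨T a, LinearMap.mem_range_self T a⟩).symm

variable {X : Type*} [NormedAddCommGroup X] [InnerProductSpace ℝ X] [CompleteSpace X]
variable [MeasurableSpace X] [BorelSpace X] [SecondCountableTopology X]
variable {ν : Measure X} {R : X →L[ℝ] X} {v : X → X → ℝ} {u : X → ℝ}

/-- `C¹_b(X)` as a vector space. -/
def c1bSubmodule (X : Type*) [NormedAddCommGroup X] [InnerProductSpace ℝ X] [CompleteSpace X] :
    Submodule ℝ (X → ℝ) where
  carrier := {f | IsC1b f}
  zero_mem' := isC1b_const 0
  add_mem' := fun ha hb => IsC1b.add ha hb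
  smul_mem' := fun c _ ha => IsC1b.const_mul ha c

lemma memLp_field {κ : Type*} (s : Finset κ) {f : κ → X → ℝ} (hf : ∀ i ∈ s, IsC1b (f i)) (y : κ → X)
    (μ : Measure X) [IsFiniteMeasure μ] (p : ℝ≥0∞) : MemLp (fun x => ∑ i ∈ s, f i x • y i) p μ :=
  memLp_finsetSum _ fun i hi => by
    obtain ⟨C, hC⟩ := (hf i hi).bounded
    refine MemLp.of_bound ((hf i hi).continuous.smul continuous_const).aestronglyMeasurable
      (C * ‖y i‖) (.of_forall fun x => ?_)
    rw [norm_smul]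
    exact mul_le_mul_of_nonneg_right (hC x) (norm_nonneg _)

/-- A pairing which is dominated by `μ` is continuous in `L²(μ; X)`, and so it has a density with
respect to `μ`. -/
lemma exists_density (hu : Integrable u ν) (huv : ∀ z, Integrable (fun x => u x * v z x) ν)
    (μ : Measure X) [IsFiniteMeasure μ]
    (hμ : ∀ (s : Finset X) (f : X → X → ℝ), (∀ z, IsC1b (f z)) →
      ∑ z ∈ s, pairing ν R v u (f z) z ≤ ∫ x, ‖∑ z ∈ s, f z x • R z‖ ∂μ) :
    ∃ ρ : X → X, Integrable ρ μ ∧ ∀ (f : X → ℝ) (z : X), IsC1b f →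
      pairing ν R v u f z = ∫ x, f x * inner ℝ (R z) (ρ x) ∂μ := by
  -- Formal fields: `Finsupp.single z f` stands for the field `f • R z`.
  let Φ : (X →₀ c1bSubmodule X) →ₗ[ℝ] (X → X) := Finsupp.lsum ℝ fun z =>
    { toFun := fun f x => (f : X → ℝ) x • R z
      map_add' := fun a b => by ext k; simp [add_smul]
      map_smul' := fun c a => by ext k; simp [mul_smul] }
  let Λ : (X →₀ c1bSubmodule X) →ₗ[ℝ] ℝ := Finsupp.lsum ℝ fun z =>
    { toFun := fun f => pairing ν R v u f z
      map_add' := fun a b => pairing_add hu huv a.2 b.2 z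
      map_smul' := fun c a => pairing_const_mul c a.2 z }
  have hΦ : ∀ a, Φ a = fun x => ∑ z ∈ a.support, (a z : X → ℝ) x • R z := by
    intro a
    ext1 x
    simp only [Φ, Finsupp.lsum_apply, Finsupp.sum, Finset.sum_apply]
    rfl
  have hΛ : ∀ a, Λ a = ∑ z ∈ a.support, pairing ν R v u (a z : X → ℝ) z := fun a => rfl
  have hmem : ∀ a, MemLp (Φ a) 2 μ := fun a => by
    rw [hΦ]
    exact memLp_field _ (fun z _ => (a z).2) _ μ 2
  let T : (X →₀ c1bSubmodule X) →ₗ[ℝ] Lp X 2 μ :=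
    { toFun := fun a => (hmem a).toLp (Φ a)
      map_add' := fun a b => by
        rw [← MemLp.toLp_add]
        exact MemLp.toLp_congr _ _ (.of_forall fun x => by rw [map_add])
      map_smul' := fun c a => by
        rw [RingHom.id_apply, ← MemLp.toLp_const_smul]
        exact MemLp.toLp_congr _ _ (.of_forall fun x => by rw [map_smul]) }
  have hT : ∀ a, T a = (hmem a).toLp (Φ a) := fun a => rfl
  obtain ⟨K, hK, hle⟩ := exists_integral_norm_le_eLpNorm_two (E := X) μ
  obtain ⟨w, hw⟩ := exists_inner_eq_of_le_norm (V := X →₀ c1bSubmodule X) T Λ K fun a => by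
    rw [hT, Lp.norm_toLp]
    refine le_trans ?_ (hle _ (hmem a))
    rw [hΛ, hΦ]
    exact hμ _ _ fun z => (a z).2
  refine ⟨w, (Lp.memLp w).integrable one_le_two, fun f z hf => ?_⟩
  have h1 := hw (Finsupp.single z ⟨f, hf⟩)
  have e1 : Λ (Finsupp.single z ⟨f, hf⟩) = pairing ν R v u f z := by
    simp only [Λ, Finsupp.lsum_single]
    rfl
  have e2 : Φ (Finsupp.single z ⟨f, hf⟩) = fun x => f x • R z := by
    simp only [Φ, Finsupp.lsum_single]
    rfl
  rw [e1, L2.inner_def] at h1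
  rw [h1]
  refine integral_congr_ae ?_
  filter_upwards [(hmem (Finsupp.single z ⟨f, hf⟩)).coeFn_toLp] with x hx
  rw [hT, hx, e2, real_inner_smul_right, real_inner_comm]

variable [IsProbabilityMeasure ν]

/-- The pairing with an arbitrary field is dominated by a measure on `X`. -/
lemma exists_measure_sum_pairing_le {ι : Type*} (h : HilbertBasis ι ℝ X)
    (hv : IsLogDerivFamily ν R v) (hR : IsSelfAdjoint R) (hu : Integrable u ν)
    (huv : ∀ z, Integrable (fun x => u x * v z x) ν) (hV : V0 ν R u < ∞) :
    ∃ μ : Measure X, IsFiniteMeasure μ ∧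
      ∀ (n : ℕ) (f : Fin n → X → ℝ) (z : Fin n → X), (∀ i, IsC1b (f i)) →
        ∑ i, pairing ν R v u (f i) (z i) ≤ ∫ x, ‖∑ i, f i x • R (z i)‖ ∂μ := by
  have := countable_of_hilbertBasis h
  obtain ⟨μ, hμ, hmass, hle⟩ := exists_measure_compactification h hv hR hu huv hV
  have hm := measurableSet_squareSummable (ι := ι)
  have hcut : ∀ (n : ℕ) (f : Fin n → X → ℝ) (z : Fin n → X), (∀ i, IsC1b (f i)) →
      ∀ t : ℝ, 0 < t → ∀ S, ∑ i, pairing ν R v u (cutoff h (f i) t S) (z i)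
        ≤ ∫ k, ‖∑ i, cutoffE h (f i) t S k • R (z i)‖ ∂μ := by
    intro n f z hf t ht S
    choose C hC using fun i => (hf i).bounded
    have := hle n (fun i => ⟨cutoffE h (f i) t S,
      continuous_cutoffE h (hf i).continuous (hC i) ht S⟩) z
    simp only [ContinuousMap.coe_mk, cutoffE_coordE] at this
    exact this fun i => (hf i).cutoff h ht S
  have hlim : ∀ (n : ℕ) (f : Fin n → X → ℝ) (z : Fin n → X), (∀ i, IsC1b (f i)) →
      Tendsto (fun p : ℝ × Finset ι => ∑ i, pairing ν R v u (cutoff h (f i) p.1 p.2) (z i))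
        (𝓝[>] 0 ×ˢ atTop) (𝓝 (∑ i, pairing ν R v u (f i) (z i))) := fun n f z hf =>
    tendsto_finsetSum _ fun i _ => tendsto_pairing_cutoff h hu huv (hf i) (z i)
  -- No mass escapes to infinity: for fixed `t`, letting `S` grow shows that `L` of an admissible
  -- field is at most the mass of the square summable sequences, whence so is `V0`.
  have hnull : ∀ᵐ k ∂μ, k ∈ squareSummable ι := by
    have hV' : V0 ν R u ≤ ENNReal.ofReal (μ.real (squareSummable ι)) := by
      refine V0_le hv hR hu huv fun n f z hf h1 => ENNReal.ofReal_le_ofReal ?_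
      refine le_of_forall_pos_le_add fun δ hδ => ?_
      have hev := ((hlim n f z hf).eventually_const_le
        (sub_lt_self (∑ i, pairing ν R v u (f i) (z i)) hδ)).curry
      obtain ⟨t, ht, ht0⟩ := (hev.and (eventually_mem_nhdsWithin (a := (0 : ℝ)) (s := Ioi 0))).exists
      have := le_measureReal_squareSummable (μ := μ) ht0 (ht.mono fun S hS =>
        (hS.trans (hcut n f z hf t ht0 S)).trans ?_)
      · linarith
      refine integral_mono_of_nonneg (.of_forall fun k => norm_nonneg _)
        (integrable_prod_gaussE ht0 S) (.of_forall fun k => ?_)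
      simp only [cutoffE, mul_comm (f _ _), mul_smul, ← Finset.smul_sum]
      rw [norm_smul, Real.norm_of_nonneg (prod_gaussE_nonneg t S k)]
      exact mul_le_of_le_one_right (prod_gaussE_nonneg t S k) (h1 _)
    have h2 : μ.real univ ≤ μ.real (squareSummable ι) := by
      rw [hmass]
      exact ENNReal.toReal_le_of_le_ofReal measureReal_nonneg hV'
    have h3 := measureReal_add_measureReal_compl (μ := μ) hm
    have h4 : μ.real (squareSummable ι)ᶜ = 0 :=
      le_antisymm (by linarith) measureReal_nonneg
    exact (measureReal_eq_zero_iff).1 h4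
  have hΨ := measurable_indicator_ofCoordE h
  refine ⟨μ.map ((squareSummable ι).indicator (ofCoordE h)), inferInstance, fun n f z hf => ?_⟩
  choose C hC using fun i => (hf i).bounded
  have hbound : ∀ p : ℝ × Finset ι, p.1 ∈ Ioc (0 : ℝ) 1 →
      ∑ i, pairing ν R v u (cutoff h (f i) p.1 p.2) (z i)
        ≤ ∫ x, ‖∑ i, cutoff h (f i) p.1 p.2 x • R (z i)‖
          ∂(μ.map ((squareSummable ι).indicator (ofCoordE h))) := by
    intro p hp
    refine (hcut n f z hf p.1 hp.1 p.2).trans (le_of_eq ?_)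
    rw [integral_map hΨ.aemeasurable (continuous_field
      (fun i => (hf i).cutoff h hp.1 p.2) _).norm.aestronglyMeasurable]
    refine integral_congr_ae (hnull.mono fun k hk => ?_)
    simp only [indicator_of_mem hk, ← cutoffE_coordE, coordE_ofCoordE h hk]
  refine le_of_tendsto_of_tendsto (hlim n f z hf) ?_
    (eventually_mem_Ioc.mono hbound)
  refine tendsto_integral_filter_of_dominated_convergence (fun _ => ∑ i, C i * ‖R (z i)‖)
    (eventually_mem_Ioc.mono fun p hp => (continuous_field
      (fun i => (hf i).cutoff h hp.1 p.2) _).norm.aestronglyMeasurable)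
    (eventually_mem_Ioc.mono fun p hp => .of_forall fun x => ?_) (integrable_const _)
    (.of_forall fun x => ?_)
  · rw [norm_norm]
    refine (norm_sum_le _ _).trans (Finset.sum_le_sum fun i _ => ?_)
    rw [norm_smul]
    exact mul_le_mul_of_nonneg_right (abs_cutoff_le h (hC i) hp.1.le _ _) (norm_nonneg _)
  · exact (tendsto_finsetSum _ fun i _ =>
      (tendsto_cutoff h (hf i).continuous x).smul_const _).norm

lemma exists_isBV0Measure {ι : Type*} (h : HilbertBasis ι ℝ X)
    (hv : IsLogDerivFamily ν R v) (hR : IsSelfAdjoint R) (hu : Integrable u ν)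
    (huv : ∀ z, Integrable (fun x => u x * v z x) ν) (hV : V0 ν R u < ∞) :
    ∃ m : VectorMeasure X X, IsBV0Measure ν R v u m := by
  obtain ⟨μ, hμ, hle⟩ := exists_measure_sum_pairing_le h hv hR hu huv hV
  obtain ⟨ρ, hρ, hrep⟩ := exists_density (R := R) (v := v) hu huv μ fun s f hf => by
    have hsum : ∀ a : X → ℝ, ∑ i ∈ s, a i = ∑ j, a (s.equivFin.symm j) := fun a => by
      rw [← Finset.sum_coe_sort, ← s.equivFin.symm.sum_comp]
    have hsum' : ∀ a : X → X, ∑ i ∈ s, a i = ∑ j, a (s.equivFin.symm j) := fun a => by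
      rw [← Finset.sum_coe_sort, ← s.equivFin.symm.sum_comp]
    rw [hsum]
    simp only [hsum']
    exact hle _ _ (fun j => ((s.equivFin.symm j : s) : X)) fun j => hf _
  refine ⟨μ.withDensityᵥ ρ, variation_withDensityᵥ_lt_top hρ, fun y z hzy φ hφ => ?_⟩
  subst hzy
  obtain ⟨C, hC⟩ := hφ.bounded
  rw [integral_innerMeasure_withDensityᵥ hρ _ hφ.measurable hC, ← hrep φ z hφ, pairing,
    ← integral_neg]
  congr 1
  ext x
  rw [inner_gradient]
  ring

end Existence

end BVHilbert

theorem mainTheorem3 {X : Type*} [NormedAddCommGroup X] [InnerProductSpace ℝ X] [CompleteSpace X]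
    [SecondCountableTopology X] [MeasurableSpace X] [BorelSpace X]
    (ν : Measure X) [IsProbabilityMeasure ν]
    (R : X →L[ℝ] X) (v : X → X → ℝ) (hv : BVHilbert.IsLogDerivFamily ν R v)
    (hR_adj : IsSelfAdjoint R) (hR_inj : Function.Injective R)
    {ι : Type*} (h : HilbertBasis ι ℝ X) (h_eig : ∀ k, ∃ c : ℝ, R (h k) = c • h k)
    (p : ℝ≥0∞) (hp : 1 < p) (u : X → ℝ) (hu : MemLp u p ν) :
    (BVHilbert.IsBV0 ν R v u ↔ BVHilbert.V0 ν R u < ∞) ∧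
      ∀ m₀ : VectorMeasure X X, BVHilbert.IsBV0Measure ν R v u m₀ →
        m₀.variation univ = BVHilbert.V0 ν R u := by
  have hu1 : Integrable u ν := hu.integrable hp.le
  have huv : ∀ z, Integrable (fun x => u x * v z x) ν := hv.integrable_mul hp hu
  refine ⟨⟨fun hBV => ?_, fun hV => ?_⟩, fun m₀ hm₀ => ?_⟩
  · obtain ⟨m₀, hm₀⟩ := hBV.exists_measure
    exact (hm₀.V0_le_variation hv hR_adj hu1 huv).trans_lt hm₀.variation_lt_top
  · exact ⟨hu1, huv, BVHilbert.exists_isBV0Measure h hv hR_adj hu1 huv hV⟩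
  · exact hm₀.variation_eq hv hR_adj hR_inj hu1 huv
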